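/- Let $\Psi$ be a (strictly) stationary random field on $\mathbb{R}^d$ with continuous sample paths which is almost surely strictly positive (almost surely, $\Psi(s)>0$ for all $s$) and satisfies $c_\Psi=\mathbb{E}\,\Psi(o)<\infty$, where $o$ is the origin. Let $X$ be a non-negative random field on $\mathbb{R}^d$ with continuous sample paths and law $\mathbb{P}_X$ on $C(\mathbb{R}^d)$ (equipped with the topology of locally uniform convergence) such that $$\mathbb{E}_X\Big(\int_{\mathbb{R}^d}\sup_{t\in K}X(t-s)\,\mathrm{d}s\Big)<\infty\quad\text{for every compact }K\subset\mathbb{R}^d$$ and such that there is $r>0$ with $\mathbb{P}_X\big(X(s)>0\text{ for all } s \text{ with } \|s\|\le r\big)>0$. Let $\mu_Y,\mu_Z>0$ be constants. Let $Y(t)=\bigvee_{i\ge1}u_iX_i(t-s_i)$, $t\in\mathbb{R}^d$, where $\sum_{i\ge 1}\delta_{(s_i,u_i,X_i)}$ is a Cox process on $\mathbb{R}^d\times(0,\infty]\times C(\mathbb{R}^d)$ directed by the random measure $\mathrm{d}\Lambda(s,u,x)=\mu_Y^{-1}\Psi(s)\,\mathrm{d}s\,u^{-2}\,\mathrm{d}u\,\mathrm{d}\mathbb{P}_X(x)$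 (that is, conditionally on $\Lambda$ it is a Poisson process with directing measure $\Lambda$). Let $Z(t)=\bigvee_{i\ge1}u_iX_i(t-s_i)$, where now $\sum_{i\ge 1}\delta_{(s_i,u_i,X_i)}$ is a Poisson process with directing measure $\mu_Z^{-1}\,\mathrm{d}s\,u^{-2}\,\mathrm{d}u\,\mathrm{d}\mathbb{P}_X(x)$. Then, almost surely, the random fields $Y$ and $Z$ are finite on compact sets (their suprema over compact sets are finite) and have continuous sample paths, and $Y$ lies in the max-domain of attraction of $Z$: if $Y_1,Y_2,\dots$ are i.i.d. copies of $Y$, there are continuous functions $a_n>0$ and $b_n$ on $\mathbb{R}^d$ such that $a_n\big(\bigvee_{i=1}^nY_i-b_n\big)$ converges weakly in $C(\mathbb{R}^d)$ to $Z$. More precisely, if $$\mu_Y=\mathbb{E}_\Psi\Big(\mathbb{E}_X\int_{\mathbb{R}^d}X(t-s)\Psi(s)\,\mathrm{d}s\Big)$$ (for some $t\in\mathbb{R}^d$; the value $c_\Psi\,\mathbb{E}_X\int_{\mathbb{R}^d} X(s)\,\mathrm{d}s$ does not depend on $t$) and $\mu_Z=\mu_Y/c_\Psi$, then $$n^{-1}\bigvee_{i=1}^nY_i\longrightarrow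 Z\qquad\text{weakly in }C(\mathbb{R}^d)\text{ as }n\to\infty.$$ -/

import Mathlib

open MeasureTheory ProbabilityTheory Filter Set
open scoped ENNReal NNReal Topology Nat

noncomputable section

namespace CoxExtremal

/-- `d`-dimensional Euclidean space. -/
abbrev Space (d : ℕ) : Type := EuclideanSpace ℝ (Fin d)

/-- The space `C(ℝᵈ)` of continuous real functions; Mathlib's topology on it is the compact-open
topology, i.e. that of locally uniform convergence (the usual Fréchet topology). -/
abbrev Path (d : ℕ) : Type := C(Space d, ℝ)

/-- `C(ℝᵈ)` carries its Borel σ-algebra. -/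
instance instMeasurableSpacePath (d : ℕ) : MeasurableSpace (Path d) := borel (Path d)

instance instBorelSpacePath (d : ℕ) : BorelSpace (Path d) := ⟨rfl⟩

/-- The space of triples `(s, u, x)`: storm centre, severity and storm shape. The severity is
recorded as a real number; all directing measures used below are carried by `u > 0`. -/
abbrev Mark (d : ℕ) : Type := Space d × ℝ × Path d

section PointProcesses

variable {Ω S : Type*} [MeasurableSpace Ω] [MeasurableSpace S]

/-- The random counting measure `∑ᵢ δ_{pᵢ}` with points `p₀, p₁, …`. -/
def pointMeasure (p : ℕ → Ω → S) (ω : Ω) : Measure S :=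
  Measure.sum fun i => Measure.dirac (p i ω)

/-- `N` is a Poisson process with directing measure `lam`: `N B` is Poisson distributed with
parameter `lam B` whenever `lam B < ∞`, and the counts of disjoint measurable sets are
independent. -/
structure IsPoissonProcess (N : Ω → Measure S) (lam : Measure S) (P : Measure Ω) : Prop where
  measurable_process : Measurable N
  law_count : ∀ B : Set S, MeasurableSet B → lam B < ∞ →
    P.map (fun ω => N ω B) =
      (poissonMeasure (lam B).toNNReal).map (fun n : ℕ => (n : ℝ≥0∞))
  indep_count : ∀ (k : ℕ) (B : Fin k → Set S), (∀ j, MeasurableSet (B j)) →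
    Pairwise (fun i j => Disjoint (B i) (B j)) → iIndepFun (fun j ω => N ω (B j)) P

/-- `N` is a Cox process directed by the random measure `Lam`: conditionally on `Lam`, it is a
Poisson process with directing measure `Lam`. That is, given `Lam`, the counts of disjoint
measurable sets `B₁, …, B_k` are independent and Poisson distributed with parameters `Lam B_j`
(on the event that these parameters are finite). -/
structure IsCoxProcess (N Lam : Ω → Measure S) (P : Measure Ω) : Prop where
  measurable_process : Measurable N
  measurable_directing : Measurable Lam
  cond_count : ∀ (k : ℕ) (B : Fin k → Set S), (∀ j, MeasurableSet (B j)) →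
    Pairwise (fun i j => Disjoint (B i) (B j)) → ∀ m : Fin k → ℕ,
      ∀ᵐ ω ∂P, (∀ j, Lam ω (B j) < ∞) →
        (P⟦{ω' | ∀ j, N ω' (B j) = (m j : ℝ≥0∞)} |
            MeasurableSpace.comap Lam Measure.instMeasurableSpace⟧) ω =
          ∏ j, Real.exp (-(Lam ω (B j)).toReal) * (Lam ω (B j)).toReal ^ m j / ((m j)! : ℝ)

end PointProcesses

section Fields

variable {d : ℕ} {Ω Ω' : Type*} [MeasurableSpace Ω] [MeasurableSpace Ω']

/-- The measure `μ⁻¹ ψ(s) ds × u⁻² du × P_X(dx)` on `ℝᵈ × (0, ∞) × C(ℝᵈ)`. -/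
def stormIntensity (μ : ℝ) (ψ : Space d → ℝ) (PX : Measure (Path d)) : Measure (Mark d) :=
  ENNReal.ofReal μ⁻¹ •
    ((volume : Measure (Space d)).withDensity (fun s => ENNReal.ofReal (ψ s))).prod
      ((((volume : Measure ℝ).restrict (Ioi 0)).withDensity
        (fun u => ENNReal.ofReal (u ^ 2)⁻¹)).prod PX)

/-- The extremal field `t ↦ ⋁ᵢ uᵢ Xᵢ(t - sᵢ)`, a priori with values in `[0, ∞]`, built from the
points `pᵢ = (sᵢ, uᵢ, Xᵢ)`. -/
def extremalField (p : ℕ → Ω → Mark d) (ω : Ω) (t : Space d) : ℝ≥0∞ :=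
  ⨆ i, ENNReal.ofReal ((p i ω).2.1 * (p i ω).2.2 (t - (p i ω).1))

open Classical in
/-- A `[0, ∞]`-valued function regarded as an element of `C(ℝᵈ)`, when it is finite and
continuous. (The value `0` otherwise is irrelevant: it is used only for fields whose
paths are almost surely finite and continuous.) -/
def toPath (f : Space d → ℝ≥0∞) : Path d :=
  if h : (∀ t, f t < ∞) ∧ Continuous (fun t => (f t).toReal) then
    ⟨fun t => (f t).toReal, h.2⟩
  else 0

/-- Almost surely, the field `Y` is bounded on every compact set by a finite number and has
continuous sample paths; and it thereby is (up to a null set) a random element of `C(ℝᵈ)`. -/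
def FiniteAndSampleContinuous (Y : Ω → Space d → ℝ≥0∞) (P : Measure Ω) : Prop :=
  (∀ᵐ ω ∂P, (∀ K : Set (Space d), IsCompact K → (⨆ t ∈ K, Y ω t) < ∞) ∧
    Continuous (fun t => (Y ω t).toReal)) ∧
  AEMeasurable (fun ω => toPath (Y ω)) P

/-- Strict stationarity: the finite-dimensional distributions are translation invariant. -/
def IsStationary (Psi : Ω → Path d) (P : Measure Ω) : Prop :=
  ∀ (h : Space d) (k : ℕ) (t : Fin k → Space d),
    IdentDistrib (fun ω (j : Fin k) => Psi ω (t j + h)) (fun ω (j : Fin k) => Psi ω (t j)) P P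

/-- `E_X ∫ sup_{t ∈ K} X(t - s) ds < ∞` for all compact `K`. -/
def StormIntegrable (PX : Measure (Path d)) : Prop :=
  ∀ K : Set (Space d), IsCompact K →
    (∫⁻ x, ∫⁻ s, (⨆ t ∈ K, ENNReal.ofReal (x (t - s))) ∂volume ∂PX) < ∞

/-- With positive probability `X` is strictly positive on some fixed closed ball around the
origin. -/
def StormSupport (PX : Measure (Path d)) : Prop :=
  ∃ r : ℝ, 0 < r ∧ 0 < PX {x | Metric.closedBall (0 : Space d) r ⊆ {s | 0 < x s}}

/-- `E_Ψ (E_X ∫ X(t - s) Ψ(s) ds)`. -/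
def meanStormIntegral (Psi : Ω → Path d) (P : Measure Ω) (PX : Measure (Path d))
    (t : Space d) : ℝ≥0∞ :=
  ∫⁻ ω, ∫⁻ x, ∫⁻ s, ENNReal.ofReal (x (t - s)) * ENNReal.ofReal (Psi ω s) ∂volume ∂PX ∂P

/-- `Y₀, Y₁, …` are independent copies of the random element `Y` of `C(ℝᵈ)`. -/
def AreIIDCopies (Yc : ℕ → Ω' → Path d) (P' : Measure Ω') (Y : Ω → Path d)
    (P : Measure Ω) : Prop :=
  iIndepFun Yc P' ∧ ∀ i, IdentDistrib (Yc i) Y P' P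

/-- The pointwise maximum of the first `n + 1` random functions. -/
def maxFirst (Yc : ℕ → Ω' → Path d) (n : ℕ) (ω : Ω') : Path d :=
  (Finset.range (n + 1)).sup' Finset.nonempty_range_add_one (fun i => Yc i ω)

/-- The common law of the i.i.d. sequence `Y₀, Y₁, …` is in the max-domain of attraction of `Z`:
for suitable continuous norming functions `aₙ > 0` and `bₙ`, the fields `aₙ (⋁_{i ≤ n} Yᵢ - bₙ)`
converge weakly in `C(ℝᵈ)` to `Z`. -/
def InMaxDomainOfAttraction (Yc : ℕ → Ω' → Path d) (P' : Measure Ω') [IsProbabilityMeasure P']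
    (Z : Ω → Path d) (Q : Measure Ω) [IsProbabilityMeasure Q] : Prop :=
  ∃ a b : ℕ → Path d, (∀ n t, 0 < a n t) ∧
    TendstoInDistribution (fun n ω => a n * (maxFirst Yc n ω - b n)) atTop Z (fun _ => P') Q

end Fields

end CoxExtremal

end

/-! The maximum of `n` independent copies of `Y`, multiplied by `c / n`, is the extremal field of a
superposition of `n` independent Cox processes whose severities are multiplied by `c / n`. Since
`u⁻² du` is homogeneous (`map_mul_severity`), this rescaling only multiplies the directing measure
`Λ` by `c / n`. The superposition therefore avoids a set `D` with probability `(E exp(-(c/n)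
Λ(D)))ⁿ`, which tends to `exp(-c E Λ(D))` (`tendsto_integral_exp_pow`). By stationarity `E Λ` is a
multiple of `ds u⁻² du dP_X` (`lintegral_stormIntensity`), so for the right `c` the limit is the
void probability of the Poisson process of `Z`.

It remains to pass from void probabilities to weak convergence in `C(ℝᵈ)`
(`measure_open_le_liminf_of_void`). Inclusion-exclusion gives convergence of the joint probabilities
of hitting some sets and avoiding others. Fix a compact `K` and a level `η`. The marks whose storm
exceeds `η` on `K` have finite mean measure and split into countably many cells of storms that
differ by at most `2 η` on `K`. The list of hit cells determines the maximum on `K` up to `2 η`, and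
cells of large index are hit with small probability. Up to a small error an open set of paths is
thus described by finitely many hit patterns, and the portmanteau theorem applies.

The same cells give finiteness and continuity: almost surely only finitely many are hit, so on
compacts the field is a uniform limit of finite maxima of storms. -/

open MeasureTheory ProbabilityTheory Filter Set
open scoped ENNReal NNReal Topology Nat

noncomputable section

namespace CoxExtremal

/-! ### Random continuous functions -/

section Paths

variable {d : ℕ}

/-- The paths that are uniformly within `η` of `g` on `K`. -/
def tube (K : Set (Space d)) (η : ℝ) (g : Path d) : Set (Path d) :=
  {h | ∀ t ∈ K, |h t - g t| ≤ η}

lemma isClosed_tube (K : Set (Space d)) (η : ℝ) (g : Path d) : IsClosed (tube K η g) := by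
  have : tube K η g = ⋂ t ∈ K, {h : Path d | |h t - g t| ≤ η} := by
    ext h; simp [tube]
  rw [this]
  refine isClosed_biInter fun t _ => isClosed_le ?_ continuous_const
  exact ((continuous_eval_const (F := Path d) t).sub continuous_const).abs

lemma tube_mem_nhds {K : Set (Space d)} (hK : IsCompact K) {η : ℝ} (hη : 0 < η) (g : Path d) :
    tube K η g ∈ 𝓝 g := by
  have hb := nhds_basis_uniformity'
    (ContinuousMap.hasBasis_compactConvergenceUniformity (α := Space d) (β := ℝ)) (x := g)
  refine mem_of_superset
    (hb.mem_of_mem (i := (K, {p : ℝ × ℝ | dist p.1 p.2 < η})) ⟨hK, Metric.dist_mem_uniformity hη⟩) ?_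
  intro h hh t ht
  have := hh t ht
  simp only [mem_ofPred_eq, Real.dist_eq] at this
  rw [abs_sub_comm]
  exact this.le

lemma exists_tube_subset {G : Set (Path d)} (hG : IsOpen G) {g : Path d} (hg : g ∈ G) :
    ∃ n : ℕ, tube (Metric.closedBall 0 n) (1 / ((n : ℝ) + 1)) g ⊆ G := by
  have hb := nhds_basis_uniformity'
    (ContinuousMap.hasBasis_compactConvergenceUniformity (α := Space d) (β := ℝ)) (x := g)
  obtain ⟨⟨K, V⟩, ⟨hK, hV⟩, hKV⟩ := hb.mem_iff.1 (hG.mem_nhds hg)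
  obtain ⟨ε, hε, hεV⟩ := Metric.mem_uniformity_dist.1 hV
  obtain ⟨R, hR⟩ := hK.isBounded.subset_closedBall (0 : Space d)
  obtain ⟨n₁, hn₁⟩ := exists_nat_ge R
  obtain ⟨n₂, hn₂⟩ := exists_nat_one_div_lt hε
  refine ⟨max n₁ n₂, fun h hh => hKV fun t ht => hεV ?_⟩
  have ht' : t ∈ Metric.closedBall (0 : Space d) ((max n₁ n₂ : ℕ) : ℝ) :=
    Metric.closedBall_subset_closedBall (hn₁.trans (by exact_mod_cast le_max_left _ _)) (hR ht)
  have h1 := hh t ht'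
  rw [dist_comm, Real.dist_eq]
  refine h1.trans_lt (lt_of_le_of_lt ?_ hn₂)
  have : (n₂ : ℝ) ≤ ((max n₁ n₂ : ℕ) : ℝ) := by exact_mod_cast le_max_right _ _
  gcongr

lemma tube_subset_tube {K K' : Set (Space d)} {η η' : ℝ} (hK : K ⊆ K') (hη : η' ≤ η)
    (g : Path d) : tube K' η' g ⊆ tube K η g :=
  fun _ hh t ht => (hh t (hK ht)).trans hη

/-- The Borel σ-algebra on `C(ℝᵈ)` is generated by the evaluations. -/
lemma measurable_path_of_eval {Ω : Type*} [MeasurableSpace Ω] {F : Ω → Path d}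
    (hF : ∀ t, Measurable fun ω => F ω t) : Measurable F := by
  have htube : ∀ (K : Set (Space d)) (η : ℝ) (g : Path d), MeasurableSet (F ⁻¹' tube K η g) := by
    intro K η g
    -- By continuity the closed condition defining a tube need only be tested on a countable dense
    -- subset of `K`.
    obtain ⟨s, hsK, hsc, hsd⟩ : ∃ s ⊆ K, s.Countable ∧ K ⊆ closure s := by
      obtain ⟨u, huc, hud⟩ := TopologicalSpace.exists_countable_dense K
      exact ⟨_, Subtype.coe_image_subset K u, huc.image _, Subtype.dense_iff.1 hud⟩
    have : F ⁻¹' tube K η g = ⋂ t ∈ s, {ω | |F ω t - g t| ≤ η} := by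
      ext ω
      simp only [tube, mem_preimage, mem_ofPred_eq, mem_iInter]
      refine ⟨fun h t ht => h t (hsK ht), fun h t ht => ?_⟩
      have hcl : IsClosed {t | |F ω t - g t| ≤ η} :=
        isClosed_le (by fun_prop) continuous_const
      exact hcl.closure_subset_iff.2 (fun t ht => h t ht) (hsd ht)
    rw [this]
    refine MeasurableSet.biInter hsc fun t _ => measurableSet_le ?_ measurable_const
    exact ((hF t).sub_const _).abs
  refine measurable_of_isOpen fun G hG => ?_
  let D := TopologicalSpace.denseSeq (Path d)
  have hunion : G = ⋃ p : {p : ℕ × ℕ |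
      tube (Metric.closedBall 0 p.2) (1 / ((p.2 : ℝ) + 1)) (D p.1) ⊆ G},
      tube (Metric.closedBall 0 p.1.2) (1 / ((p.1.2 : ℝ) + 1)) (D p.1.1) := by
    refine Subset.antisymm (fun g hg => ?_) (iUnion_subset fun p => p.2)
    obtain ⟨n, hn⟩ := exists_tube_subset hG hg
    -- Chosen so that `2 / (m + 1) = 1 / (n + 1)`: two tolerances of mesh `m` add up to the
    -- tolerance around `g`.
    let m := 2 * n + 1
    have hm0 : (0 : ℝ) < 1 / ((m : ℝ) + 1) := by positivity
    obtain ⟨k, hy⟩ := (TopologicalSpace.denseRange_denseSeq (Path d)).mem_nhds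
      (tube_mem_nhds (isCompact_closedBall (0 : Space d) (m : ℝ)) hm0 g)
    refine mem_iUnion.2 ⟨⟨(k, m), ?_⟩, ?_⟩
    · intro h hh
      refine hn fun t ht => ?_
      have htm : t ∈ Metric.closedBall (0 : Space d) (m : ℝ) :=
        Metric.closedBall_subset_closedBall (by simp only [m]; push_cast; linarith [n.cast_nonneg (α := ℝ)]) ht
      have h1 := hh t htm
      have h2 := hy t htm
      have h3 : 1 / ((m : ℝ) + 1) + 1 / ((m : ℝ) + 1) = 1 / ((n : ℝ) + 1) := by
        simp only [m]; push_cast; field_simp; ring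
      calc |h t - g t| ≤ |h t - D k t| + |D k t - g t| := abs_sub_le _ _ _
        _ ≤ _ := add_le_add h1 h2
        _ = _ := h3
    · intro t ht
      rw [abs_sub_comm]
      exact hy t ht
  rw [hunion, preimage_iUnion]
  exact MeasurableSet.iUnion fun p => htube _ _ _

/-- The paths that exceed the level `η` somewhere on `K`. -/
def exceedSet (K : Set (Space d)) (η : ℝ) : Set (Path d) := {g | ∃ t ∈ K, η < g t}

lemma isOpen_exceedSet (K : Set (Space d)) (η : ℝ) : IsOpen (exceedSet K η) := by
  have : exceedSet K η = ⋃ t ∈ K, {g : Path d | η < g t} := by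
    ext g; simp [exceedSet]
  rw [this]
  exact isOpen_biUnion fun t _ =>
    isOpen_lt continuous_const (continuous_eval_const (F := Path d) t)

/-- A countable partition of `exceedSet K η` into sets of paths that differ by at most `2 η`
on `K`. -/
def pathCell (K : Set (Space d)) (η : ℝ) (j : ℕ) : Set (Path d) :=
  exceedSet K η ∩ disjointed (fun j => tube K η (TopologicalSpace.denseSeq (Path d) j)) j

lemma measurableSet_pathCell (K : Set (Space d)) (η : ℝ) (j : ℕ) :
    MeasurableSet (pathCell K η j) :=
  (isOpen_exceedSet K η).measurableSet.inter
    (MeasurableSet.disjointed (fun _ => (isClosed_tube K η _).measurableSet) j)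

lemma pairwise_disjoint_pathCell (K : Set (Space d)) (η : ℝ) :
    Pairwise (Function.onFun Disjoint (pathCell K η)) := fun _ _ hij =>
  (disjoint_disjointed _ hij).mono inter_subset_right inter_subset_right

lemma iUnion_pathCell {K : Set (Space d)} (hK : IsCompact K) {η : ℝ} (hη : 0 < η) :
    ⋃ j, pathCell K η j = exceedSet K η := by
  unfold pathCell
  rw [← inter_iUnion, iUnion_disjointed]
  refine inter_eq_left.2 fun g _ => ?_
  obtain ⟨k, hy⟩ := (TopologicalSpace.denseRange_denseSeq (Path d)).mem_nhds
    (tube_mem_nhds hK hη g)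
  exact mem_iUnion.2 ⟨k, fun t ht => by rw [abs_sub_comm]; exact hy t ht⟩

lemma abs_sub_le_of_mem_pathCell {K : Set (Space d)} {η : ℝ} {j : ℕ} {g h : Path d}
    (hg : g ∈ pathCell K η j) (hh : h ∈ pathCell K η j) {t : Space d} (ht : t ∈ K) :
    |g t - h t| ≤ 2 * η := by
  have h1 := disjointed_subset _ _ hg.2 t ht
  have h2 := disjointed_subset _ _ hh.2 t ht
  rw [abs_le] at h1 h2 ⊢
  constructor <;> linarith [h1.1, h1.2, h2.1, h2.2]

end Paths

/-! ### Deterministic estimates for maxima of storms -/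

section Storms

variable {d : ℕ}

/-- The storm `t ↦ u x(t - s)` of a mark `(s, u, x)`. -/
def stormShape (z : Mark d) : Path d :=
  ⟨fun t => z.2.1 * z.2.2 (t - z.1), by fun_prop⟩

lemma stormShape_apply (z : Mark d) (t : Space d) :
    stormShape z t = z.2.1 * z.2.2 (t - z.1) := rfl

lemma continuous_stormShape : Continuous (stormShape (d := d)) := by
  refine ContinuousMap.continuous_of_continuous_uncurry _ ?_
  show Continuous fun p : Mark d × Space d => p.1.2.1 * p.1.2.2 (p.2 - p.1.1)
  fun_prop

/-- The maximum of the storms in `R`. -/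
def stormMax (R : Set (Mark d)) (t : Space d) : ℝ≥0∞ :=
  ⨆ z ∈ R, ENNReal.ofReal (stormShape z t)

lemma extremalField_eq_stormMax {Ω : Type*} (p : ℕ → Ω → Mark d) (ω : Ω) :
    extremalField p ω = stormMax (range fun i => p i ω) := by
  ext t
  simp only [extremalField, stormMax, iSup_range, stormShape_apply]

/-- The marks whose storm exceeds the level `η` somewhere on `K`. -/
def markExceed (K : Set (Space d)) (η : ℝ) : Set (Mark d) := stormShape ⁻¹' exceedSet K η

/-- A countable partition of `markExceed K η` into sets of marks with similar storms. -/
def markCell (K : Set (Space d)) (η : ℝ) (j : ℕ) : Set (Mark d) := stormShape ⁻¹' pathCell K η j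

/-- The union of the cells with index at least `J`. -/
def markTail (K : Set (Space d)) (η : ℝ) (J : ℕ) : Set (Mark d) := ⋃ j ≥ J, markCell K η j

lemma measurableSet_markExceed (K : Set (Space d)) (η : ℝ) : MeasurableSet (markExceed K η) :=
  ((isOpen_exceedSet K η).preimage continuous_stormShape).measurableSet

lemma measurableSet_markCell (K : Set (Space d)) (η : ℝ) (j : ℕ) :
    MeasurableSet (markCell K η j) :=
  continuous_stormShape.measurable (measurableSet_pathCell K η j)

lemma measurableSet_markTail (K : Set (Space d)) (η : ℝ) (J : ℕ) :
    MeasurableSet (markTail K η J) :=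
  MeasurableSet.iUnion fun j => MeasurableSet.iUnion fun _ => measurableSet_markCell K η j

lemma markCell_subset_markExceed (K : Set (Space d)) (η : ℝ) (j : ℕ) :
    markCell K η j ⊆ markExceed K η := fun _ hz => hz.1

lemma markTail_subset_markExceed (K : Set (Space d)) (η : ℝ) (J : ℕ) :
    markTail K η J ⊆ markExceed K η :=
  iUnion₂_subset fun j _ => markCell_subset_markExceed K η j

lemma antitone_markTail (K : Set (Space d)) (η : ℝ) : Antitone (markTail K η) :=
  fun _ _ hJ => biUnion_subset_biUnion_left fun _ hj => le_trans hJ hj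

lemma iInter_markTail (K : Set (Space d)) (η : ℝ) : ⋂ J, markTail K η J = ∅ := by
  refine eq_empty_iff_forall_notMem.2 fun z hz => ?_
  rw [mem_iInter] at hz
  obtain ⟨i, _, hi⟩ := mem_iUnion₂.1 (hz 0)
  obtain ⟨j, hj, hj'⟩ := mem_iUnion₂.1 (hz (i + 1))
  exact disjoint_left.1 (pairwise_disjoint_pathCell K η (by omega : i ≠ j)) hi hj'

/-- Continuity from above along decreasing sets with empty intersection. This is what allows all but
finitely many cells to be discarded. -/
lemma tendsto_measure_markTail (ν : Measure (Mark d)) (K : Set (Space d)) (η : ℝ)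
    (h : ν (markExceed K η) < ∞) :
    Tendsto (fun J => ν (markTail K η J)) atTop (𝓝 0) := by
  have := tendsto_measure_iInter_atTop (μ := ν)
    (fun J => (measurableSet_markTail K η J).nullMeasurableSet) (antitone_markTail K η)
    ⟨0, ((measure_mono (markTail_subset_markExceed K η 0)).trans_lt h).ne⟩
  rw [iInter_markTail, measure_empty] at this
  exact this

/-- If `R'` hits all the cells that `R` hits, then the maximum of the storms in `R'` is not much
smaller than that of the storms in `R`. -/
lemma stormMax_le_of_hits {K : Set (Space d)} (hK : IsCompact K) {η : ℝ} (hη : 0 < η)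
    {R R' : Set (Mark d)}
    (h : ∀ j, ¬ Disjoint R (markCell K η j) → ¬ Disjoint R' (markCell K η j))
    {t : Space d} (ht : t ∈ K) :
    stormMax R t ≤ stormMax R' t + ENNReal.ofReal (2 * η) := by
  refine iSup₂_le fun z hz => ?_
  by_cases hzE : z ∈ markExceed K η
  · have hzU : stormShape z ∈ ⋃ j, pathCell K η j := by
      rw [iUnion_pathCell hK hη]; exact hzE
    obtain ⟨j, hj⟩ := mem_iUnion.1 hzU
    obtain ⟨z', hz', hzj'⟩ := not_disjoint_iff.1 (h j (not_disjoint_iff.2 ⟨z, hz, hj⟩))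
    have h1 := abs_sub_le_of_mem_pathCell hj hzj' ht
    calc ENNReal.ofReal (stormShape z t)
        ≤ ENNReal.ofReal (stormShape z' t + 2 * η) :=
          ENNReal.ofReal_le_ofReal (by linarith [(abs_le.1 h1).2])
      _ ≤ ENNReal.ofReal (stormShape z' t) + ENNReal.ofReal (2 * η) := ENNReal.ofReal_add_le
      _ ≤ _ := by
        gcongr
        exact le_iSup₂ (f := fun z (_ : z ∈ R') => ENNReal.ofReal (stormShape z t)) z' hz'
  -- A storm outside every cell stays below `η` on `K`, so the error term alone absorbs it.
  · have h1 : stormShape z t ≤ η := by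
      by_contra hlt
      exact hzE ⟨t, ht, not_le.1 hlt⟩
    exact (ENNReal.ofReal_le_ofReal (by linarith)).trans le_add_self

/-- Only cells of index below `J` can be hit; one mark of `R` from each hit cell suffices for `F`.
-/
lemma exists_finite_stormMax_le {K : Set (Space d)} (hK : IsCompact K) {η : ℝ} (hη : 0 < η)
    {R : Set (Mark d)} {J : ℕ} (hJ : Disjoint R (markTail K η J)) :
    ∃ F : Set (Mark d), F.Finite ∧ F ⊆ R ∧
      ∀ t ∈ K, stormMax R t ≤ stormMax F t + ENNReal.ofReal (2 * η) := by
  classical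
  have hch : ∀ j, ∃ z, ¬ Disjoint R (markCell K η j) → z ∈ R ∧ z ∈ markCell K η j := by
    intro j
    by_cases hj : Disjoint R (markCell K η j)
    · exact ⟨0, fun h => absurd hj h⟩
    · obtain ⟨z, hz⟩ := not_disjoint_iff.1 hj
      exact ⟨z, fun _ => hz⟩
  choose z hz using hch
  refine ⟨z '' {j | j < J ∧ ¬ Disjoint R (markCell K η j)},
    ((finite_lt_nat J).subset fun j hj => hj.1).image z, ?_, fun t ht =>
    stormMax_le_of_hits hK hη (fun j hj => ?_) ht⟩
  · rintro _ ⟨j, hj, rfl⟩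
    exact (hz j hj.2).1
  · refine not_disjoint_iff.2 ⟨z j, ⟨j, ⟨?_, hj⟩, rfl⟩, (hz j hj).2⟩
    by_contra hlt
    exact hj (hJ.mono_right fun w hw => mem_iUnion₂.2 ⟨j, not_lt.1 hlt, hw⟩)

lemma stormMax_mono {R R' : Set (Mark d)} (h : R ⊆ R') (t : Space d) :
    stormMax R t ≤ stormMax R' t := biSup_mono fun _ hz => h hz

lemma stormMax_finite {F : Set (Mark d)} (hF : F.Finite) :
    (∀ t, stormMax F t < ∞) ∧ Continuous fun t => (stormMax F t).toReal := by
  induction F, hF using Set.Finite.induction_on with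
  | empty => simp [stormMax, continuous_const]
  | @insert a s _ _ ih =>
    have h : ∀ t, stormMax (insert a s) t = max (ENNReal.ofReal (stormShape a t)) (stormMax s t) :=
      fun t => by simp only [stormMax, iSup_insert]
    refine ⟨fun t => ?_, ?_⟩
    · rw [h]; exact max_lt ENNReal.ofReal_lt_top (ih.1 t)
    · have h' : ∀ t, (stormMax (insert a s) t).toReal =
          max (max (stormShape a t) 0) (stormMax s t).toReal := fun t => by
        rw [h, ENNReal.toReal_max ENNReal.ofReal_ne_top (ih.1 t).ne, ENNReal.toReal_ofReal']
      simp only [h']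
      exact (((stormShape a).continuous.max continuous_const).max ih.2)

/-- On every ball, only finitely many cells of every mesh are hit. -/
def IsTame (R : Set (Mark d)) : Prop :=
  ∀ m k : ℕ, ∃ J, Disjoint R (markTail (Metric.closedBall 0 m) (1 / ((k : ℝ) + 1)) J)

lemma IsTame.stormMax_lt_top {R : Set (Mark d)} (h : IsTame R) (t : Space d) :
    stormMax R t < ∞ := by
  obtain ⟨m, hm⟩ := exists_nat_ge ‖t‖
  obtain ⟨J, hJ⟩ := h m 0
  obtain ⟨F, hF, -, hle⟩ := exists_finite_stormMax_le (isCompact_closedBall (0 : Space d) (m : ℝ))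
    (by positivity) hJ
  exact (hle t (by simpa using hm)).trans_lt
    (ENNReal.add_lt_top.2 ⟨(stormMax_finite hF).1 t, ENNReal.ofReal_lt_top⟩)

/-- On each ball the field is a uniform limit of maxima of finitely many continuous storms. -/
lemma IsTame.continuous_stormMax {R : Set (Mark d)} (h : IsTame R) :
    Continuous fun t => (stormMax R t).toReal := by
  have hball : ∀ m : ℕ, ContinuousOn (fun t => (stormMax R t).toReal)
      (Metric.closedBall 0 m) := by
    intro m
    refine continuousOn_of_uniform_approx_of_continuousOn fun V hV => ?_
    obtain ⟨ε, hε, hεV⟩ := Metric.mem_uniformity_dist.1 hV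
    obtain ⟨k, hk⟩ := exists_nat_one_div_lt (half_pos hε)
    obtain ⟨J, hJ⟩ := h m k
    obtain ⟨F, hF, hFR, hle⟩ := exists_finite_stormMax_le
      (isCompact_closedBall (0 : Space d) (m : ℝ)) (by positivity) hJ
    refine ⟨_, (stormMax_finite hF).2.continuousOn, fun t ht => hεV ?_⟩
    have hFt := (stormMax_finite hF).1 t
    have h1 : (stormMax F t).toReal ≤ (stormMax R t).toReal :=
      ENNReal.toReal_mono (h.stormMax_lt_top t).ne (stormMax_mono hFR t)
    have h2 : (stormMax R t).toReal ≤ (stormMax F t).toReal + 2 * (1 / ((k : ℝ) + 1)) := by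
      have := ENNReal.toReal_mono (ENNReal.add_lt_top.2 ⟨hFt, ENNReal.ofReal_lt_top⟩).ne (hle t ht)
      rwa [ENNReal.toReal_add hFt.ne ENNReal.ofReal_ne_top,
        ENNReal.toReal_ofReal (by positivity)] at this
    rw [Real.dist_eq, abs_of_nonneg (sub_nonneg.2 h1)]
    linarith
  refine continuous_iff_continuousAt.2 fun t => ?_
  obtain ⟨m, hm⟩ := exists_nat_gt ‖t‖
  exact (hball m).continuousAt (Metric.closedBall_mem_nhds_of_mem (by simpa using hm))

lemma IsTame.iSup_stormMax_lt_top {R : Set (Mark d)} (h : IsTame R) {K : Set (Space d)}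
    (hK : IsCompact K) : (⨆ t ∈ K, stormMax R t) < ∞ := by
  obtain ⟨C, hC⟩ := hK.bddAbove_image h.continuous_stormMax.continuousOn
  refine lt_of_le_of_lt (iSup₂_le fun t ht => ?_) (ENNReal.ofReal_lt_top (r := C))
  rw [← ENNReal.ofReal_toReal (h.stormMax_lt_top t).ne]
  exact ENNReal.ofReal_le_ofReal (hC (mem_image_of_mem _ ht))

lemma toPath_apply {f : Space d → ℝ≥0∞} (h : (∀ t, f t < ∞) ∧ Continuous fun t => (f t).toReal)
    (t : Space d) : toPath f t = (f t).toReal := by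
  rw [toPath, dif_pos h]; rfl

lemma toPath_nonneg (f : Space d → ℝ≥0∞) (t : Space d) : 0 ≤ toPath f t := by
  by_cases h : (∀ t, f t < ∞) ∧ Continuous fun t => (f t).toReal
  · rw [toPath_apply h]; exact ENNReal.toReal_nonneg
  · rw [toPath, dif_neg h]; rfl

lemma IsTame.ofReal_toPath {R : Set (Mark d)} (h : IsTame R) (t : Space d) :
    ENNReal.ofReal (toPath (stormMax R) t) = stormMax R t := by
  rw [toPath_apply ⟨h.stormMax_lt_top, h.continuous_stormMax⟩,
    ENNReal.ofReal_toReal (h.stormMax_lt_top t).ne]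

end Storms

/-! ### Random sets of marks -/

section RandomMarks

variable {d : ℕ} {Ω : Type*} [MeasurableSpace Ω]

/-- If tameness fails at some ball and mesh, then every tail is hit there, an event of probability
at most `ν (markTail _ _ J)` for all `J`. -/
lemma ae_isTame_of_hit_le {P : Measure Ω} {ν : Measure (Mark d)} {R : Ω → Set (Mark d)}
    (hhit : ∀ D, MeasurableSet D → P {ω | ¬ Disjoint (R ω) D} ≤ ν D)
    (hν : ∀ K η, IsCompact K → 0 < η → ν (markExceed K η) < ∞) :
    ∀ᵐ ω ∂P, IsTame (R ω) := by
  refine ae_all_iff.2 fun m => ae_all_iff.2 fun k => ?_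
  rw [ae_iff]
  refine le_antisymm (ge_of_tendsto' (tendsto_measure_markTail ν (Metric.closedBall 0 m)
    (1 / ((k : ℝ) + 1)) (hν _ _ (isCompact_closedBall _ _) (by positivity))) fun J => ?_) zero_le
  refine (measure_mono fun ω hω => ?_).trans (hhit _ (measurableSet_markTail _ _ J))
  exact not_exists.1 hω J

lemma measurable_stormShape_eval (t : Space d) : Measurable fun z : Mark d => stormShape z t :=
  ((continuous_eval_const (F := Path d) t).comp continuous_stormShape).measurable

lemma measurable_extremalField {p : ℕ → Ω → Mark d} (hp : ∀ i, Measurable (p i)) (t : Space d) :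
    Measurable fun ω => extremalField p ω t :=
  Measurable.iSup fun i => ((measurable_stormShape_eval t).comp (hp i)).ennreal_ofReal

lemma aemeasurable_toPath_extremalField {P : Measure Ω} {p : ℕ → Ω → Mark d}
    (hp : ∀ i, Measurable (p i)) (h : ∀ᵐ ω ∂P, IsTame (range fun i => p i ω)) :
    AEMeasurable (fun ω => toPath (extremalField p ω)) P := by
  classical
  -- Tameness is not known to be a measurable event, so the exceptional set is enlarged to a
  -- measurable null set.
  set S := toMeasurable P {ω | ¬ IsTame (range fun i => p i ω)} with hS
  have hSm : MeasurableSet S := measurableSet_toMeasurable _ _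
  have hS0 : P S = 0 := by rw [hS, measure_toMeasurable]; exact ae_iff.1 h
  refine ⟨fun ω => if ω ∈ S then 0 else toPath (extremalField p ω), ?_, ?_⟩
  · refine measurable_path_of_eval fun t => ?_
    have : (fun ω => (if ω ∈ S then 0 else toPath (extremalField p ω) : Path d) t) =
        fun ω => if ω ∈ S then 0 else (extremalField p ω t).toReal := by
      ext ω
      by_cases hω : ω ∈ S
      · simp [hω]
      · have ht : IsTame (range fun i => p i ω) := by
          by_contra hn
          exact hω (subset_toMeasurable P _ hn)
        simp only [hω, if_false, extremalField_eq_stormMax]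
        exact toPath_apply ⟨ht.stormMax_lt_top, ht.continuous_stormMax⟩ t
    rw [this]
    exact Measurable.ite hSm measurable_const (measurable_extremalField hp t).ennreal_toReal
  · have : ∀ᵐ ω ∂P, ω ∉ S := measure_eq_zero_iff_ae_notMem.1 hS0
    filter_upwards [this] with ω hω
    simp [hω]

lemma finiteAndSampleContinuous_of_isTame {P : Measure Ω} {p : ℕ → Ω → Mark d}
    (hp : ∀ i, Measurable (p i)) (h : ∀ᵐ ω ∂P, IsTame (range fun i => p i ω)) :
    FiniteAndSampleContinuous (extremalField p) P := by
  refine ⟨?_, aemeasurable_toPath_extremalField hp h⟩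
  filter_upwards [h] with ω hω
  simp only [extremalField_eq_stormMax]
  exact ⟨fun K hK => hω.iSup_stormMax_lt_top hK, hω.continuous_stormMax⟩

/-- The event that the random set `R` avoids `D₀` and hits `D j` for all `j ∈ s`. -/
def hitPattern {Ω S ι : Type*} (R : Ω → Set S) (D₀ : Set S) (D : ι → Set S) (s : Finset ι) :
    Set Ω :=
  {ω | Disjoint (R ω) D₀ ∧ ∀ j ∈ s, ¬ Disjoint (R ω) (D j)}

/-- The inclusion-exclusion step: a requirement to hit becomes a difference of two requirements to
avoid. -/
lemma hitPattern_insert {Ω S ι : Type*} [DecidableEq ι] (R : Ω → Set S) (D₀ : Set S)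
    (D : ι → Set S) (s : Finset ι) (a : ι) :
    hitPattern R D₀ D (insert a s) = hitPattern R D₀ D s \ hitPattern R (D₀ ∪ D a) D s := by
  ext ω
  simp only [hitPattern, mem_ofPred_eq, Set.mem_sdiff, Finset.forall_mem_insert, disjoint_union_right]
  tauto

lemma measurableSet_hitPattern {S ι : Type*} [MeasurableSpace S] {R : Ω → Set S}
    (hR : ∀ D, MeasurableSet D → MeasurableSet {ω | Disjoint (R ω) D}) {D₀ : Set S}
    (hD₀ : MeasurableSet D₀) {D : ι → Set S} (hD : ∀ j, MeasurableSet (D j)) (s : Finset ι) :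
    MeasurableSet (hitPattern R D₀ D s) := by
  have : hitPattern R D₀ D s =
      {ω | Disjoint (R ω) D₀} ∩ ⋂ j ∈ s, {ω | Disjoint (R ω) (D j)}ᶜ := by
    ext ω; simp [hitPattern]
  rw [this]
  exact (hR _ hD₀).inter (Finset.measurableSet_biInter s fun j _ => (hR _ (hD j)).compl)

/-- Convergence of void probabilities implies convergence of the joint hitting probabilities. -/
lemma tendsto_measure_hitPattern {S ι : Type*} [MeasurableSpace S] {ν : Measure S}
    {P : Measure Ω} [IsProbabilityMeasure P] {R : Ω → Set S}
    (hR : ∀ D, MeasurableSet D → MeasurableSet {ω | Disjoint (R ω) D})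
    {Ω' : ℕ → Type*} [∀ n, MeasurableSpace (Ω' n)] {P' : ∀ n, Measure (Ω' n)}
    [∀ n, IsProbabilityMeasure (P' n)] {R' : ∀ n, Ω' n → Set S}
    (hR' : ∀ n D, MeasurableSet D → MeasurableSet {ω | Disjoint (R' n ω) D})
    (hvoid : ∀ D, MeasurableSet D → ν D < ∞ →
      Tendsto (fun n => P' n {ω | Disjoint (R' n ω) D}) atTop (𝓝 (P {ω | Disjoint (R ω) D})))
    {D : ι → Set S} (hD : ∀ j, MeasurableSet (D j)) (hDν : ∀ j, ν (D j) < ∞) (s : Finset ι) :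
    ∀ D₀, MeasurableSet D₀ → ν D₀ < ∞ →
      Tendsto (fun n => P' n (hitPattern (R' n) D₀ D s)) atTop (𝓝 (P (hitPattern R D₀ D s))) := by
  classical
  -- The avoided set `D₀` stays universally quantified because each step enlarges it by `D a`.
  induction s using Finset.induction_on with
  | empty =>
    intro D₀ hD₀ hν
    simpa [hitPattern] using hvoid D₀ hD₀ hν
  | insert a s _ ih =>
    intro D₀ hD₀ hν
    have hDa : MeasurableSet (D₀ ∪ D a) := hD₀.union (hD a)
    have hνa : ν (D₀ ∪ D a) < ∞ :=
      (measure_union_le _ _).trans_lt (ENNReal.add_lt_top.2 ⟨hν, hDν a⟩)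
    simp only [hitPattern_insert]
    have h1 := ENNReal.Tendsto.sub (ih D₀ hD₀ hν) (ih _ hDa hνa) (Or.inl (measure_ne_top _ _))
    have e0 : P (hitPattern R D₀ D s \ hitPattern R (D₀ ∪ D a) D s) =
        P (hitPattern R D₀ D s) - P (hitPattern R (D₀ ∪ D a) D s) :=
      measure_sdiff (fun ω hω => ⟨hω.1.mono_right subset_union_left, hω.2⟩)
        (measurableSet_hitPattern hR hDa hD s).nullMeasurableSet (measure_ne_top _ _)
    have e1 : ∀ n, P' n (hitPattern (R' n) D₀ D s \ hitPattern (R' n) (D₀ ∪ D a) D s) =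
        P' n (hitPattern (R' n) D₀ D s) - P' n (hitPattern (R' n) (D₀ ∪ D a) D s) := fun n =>
      measure_sdiff (fun ω hω => ⟨hω.1.mono_right subset_union_left, hω.2⟩)
        (measurableSet_hitPattern (hR' n) hDa hD s).nullMeasurableSet (measure_ne_top _ _)
    rw [e0]
    simpa only [e1] using h1

lemma abs_sub_le_of_stormMax_le {f f' : ℝ} (hf : 0 ≤ f) (hf' : 0 ≤ f') {a b : ℝ≥0∞} {η : ℝ}
    (hη : 0 ≤ η) (ha : ENNReal.ofReal f = a) (hb : ENNReal.ofReal f' = b)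
    (hab : a ≤ b + ENNReal.ofReal η) (hba : b ≤ a + ENNReal.ofReal η) : |f' - f| ≤ η := by
  subst ha hb
  rw [← ENNReal.ofReal_add hf' hη, ENNReal.ofReal_le_ofReal_iff (by positivity)] at hab
  rw [← ENNReal.ofReal_add hf hη, ENNReal.ofReal_le_ofReal_iff (by positivity)] at hba
  exact abs_le.2 ⟨by linarith, by linarith⟩

/-- If the void probabilities of random sets of marks converge, then the laws of the maxima of
their storms satisfy the portmanteau condition for open sets. -/
theorem measure_open_le_liminf_of_void {ν : Measure (Mark d)}
    {P : Measure Ω} [IsProbabilityMeasure P] {R : Ω → Set (Mark d)}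
    (hR : ∀ D, MeasurableSet D → MeasurableSet {ω | Disjoint (R ω) D})
    {Ω' : ℕ → Type*} [∀ n, MeasurableSpace (Ω' n)] {P' : ∀ n, Measure (Ω' n)}
    [∀ n, IsProbabilityMeasure (P' n)] {R' : ∀ n, Ω' n → Set (Mark d)}
    (hR' : ∀ n D, MeasurableSet D → MeasurableSet {ω | Disjoint (R' n ω) D})
    (hvoid : ∀ D, MeasurableSet D → ν D < ∞ →
      Tendsto (fun n => P' n {ω | Disjoint (R' n ω) D}) atTop (𝓝 (P {ω | Disjoint (R ω) D})))
    (hhit : ∀ D, MeasurableSet D → P {ω | ¬ Disjoint (R ω) D} ≤ ν D)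
    (hν : ∀ K η, IsCompact K → 0 < η → ν (markExceed K η) < ∞)
    {f : Ω → Path d} (hf0 : ∀ ω t, 0 ≤ f ω t)
    (hf : ∀ᵐ ω ∂P, ∀ t, ENNReal.ofReal (f ω t) = stormMax (R ω) t)
    {f' : ∀ n, Ω' n → Path d} (hf'0 : ∀ n ω t, 0 ≤ f' n ω t)
    (hf' : ∀ n, ∀ᵐ ω ∂P' n, ∀ t, ENNReal.ofReal (f' n ω t) = stormMax (R' n ω) t)
    {G : Set (Path d)} (hG : IsOpen G) :
    P (f ⁻¹' G) ≤ liminf (fun n => P' n (f' n ⁻¹' G)) atTop := by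
  classical
  -- Paths that lie in `G` with a margin. These sets increase to `G`, so it is enough to bound the
  -- probability of each `H m` up to `δ`.
  let H : ℕ → Set (Path d) := fun m => {g | tube (Metric.closedBall 0 m) (1 / ((m : ℝ) + 1)) g ⊆ G}
  have hHmono : Monotone H := fun m n hmn g hg => by
    have hmn' : (m : ℝ) ≤ n := by exact_mod_cast hmn
    exact (tube_subset_tube (Metric.closedBall_subset_closedBall hmn') (by gcongr) g).trans hg
  have hGH : f ⁻¹' G = ⋃ m, f ⁻¹' H m := by
    ext ω
    simp only [mem_preimage, mem_iUnion]
    refine ⟨fun h => exists_tube_subset hG h, fun ⟨m, hm⟩ => hm fun t _ => ?_⟩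
    rw [sub_self, abs_zero]; positivity
  rw [hGH, (show Monotone fun m => f ⁻¹' H m from fun m n h => preimage_mono (hHmono h)).measure_iUnion]
  refine iSup_le fun m => ENNReal.le_of_forall_pos_le_add fun δ hδ _ => ?_
  set K : Set (Space d) := Metric.closedBall 0 m with hKdef
  have hK : IsCompact K := isCompact_closedBall _ _
  -- Storms in one cell differ by up to `2 η`, which is exactly the margin of `H m`.
  set η : ℝ := 1 / ((m : ℝ) + 1) / 2 with hηdef
  have hη : 0 < η := by positivity
  have hηm : 2 * η = 1 / ((m : ℝ) + 1) := by rw [hηdef]; ring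
  obtain ⟨J, hJ⟩ := ((tendsto_measure_markTail ν K η (hν K η hK hη)).eventually
    (gt_mem_nhds (show (0 : ℝ≥0∞) < δ by exact_mod_cast hδ))).exists
  -- What must be avoided for `A` to be exactly the set of indices of hit cells.
  let V : Finset ℕ → Set (Mark d) := fun A =>
    markTail K η J ∪ ⋃ j ∈ Finset.range J \ A, markCell K η j
  have hVm : ∀ A, MeasurableSet (V A) := fun A => (measurableSet_markTail K η J).union
    (Finset.measurableSet_biUnion _ fun j _ => measurableSet_markCell K η j)
  have hVν : ∀ A, ν (V A) < ∞ := fun A => (measure_mono (union_subset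
    (markTail_subset_markExceed K η J)
    (iUnion₂_subset fun j _ => markCell_subset_markExceed K η j))).trans_lt (hν K η hK hη)
  have hkey : ∀ {Q Q' : Set (Mark d)} {A : Finset ℕ}, Disjoint Q (V A) →
      (∀ j ∈ A, ¬ Disjoint Q' (markCell K η j)) →
      ∀ j, ¬ Disjoint Q (markCell K η j) → ¬ Disjoint Q' (markCell K η j) := by
    intro Q Q' A hQ hQ' j hj
    refine hQ' j ?_
    by_contra hjA
    refine hj (hQ.mono_right fun z hz => ?_)
    by_cases hjJ : j < J
    · exact Or.inr (mem_iUnion₂.2 ⟨j, Finset.mem_sdiff.2 ⟨Finset.mem_range.2 hjJ, hjA⟩, hz⟩)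
    · exact Or.inl (mem_iUnion₂.2 ⟨j, not_lt.1 hjJ, hz⟩)
  -- The patterns realised by at least one limit path in `H m`. That path is the reference: any `f'
  -- n ω` with the same pattern is `2 η`-close to it on `K`, hence in `G`. No coupling of the
  -- probability spaces is needed.
  let 𝒜 : Finset (Finset ℕ) := (Finset.range J).powerset.filter fun A =>
    ∃ ω, ω ∈ hitPattern R (V A) (markCell K η) A ∧ f ω ∈ H m ∧
      ∀ t, ENNReal.ofReal (f ω t) = stormMax (R ω) t
  have hupper : P (f ⁻¹' H m) ≤
      ∑ A ∈ 𝒜, P (hitPattern R (V A) (markCell K η) A) + δ := by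
    have hsub : f ⁻¹' H m ≤ᵐ[P]
        ((⋃ A ∈ 𝒜, hitPattern R (V A) (markCell K η) A) ∪
          {ω | ¬ Disjoint (R ω) (markTail K η J)} : Set Ω) := by
      filter_upwards [hf] with ω hω hωH
      by_cases ht : Disjoint (R ω) (markTail K η J)
      · left
        let A := (Finset.range J).filter fun j => ¬ Disjoint (R ω) (markCell K η j)
        have hA : ω ∈ hitPattern R (V A) (markCell K η) A := by
          refine ⟨disjoint_union_right.2 ⟨ht, disjoint_iUnion₂_right.2 fun j hj => ?_⟩,
            fun j hj => (Finset.mem_filter.1 hj).2⟩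
          by_contra hn
          exact (Finset.mem_sdiff.1 hj).2 (Finset.mem_filter.2 ⟨(Finset.mem_sdiff.1 hj).1, hn⟩)
        exact mem_iUnion₂.2 ⟨A, Finset.mem_filter.2
          ⟨Finset.mem_powerset.2 (Finset.filter_subset _ _), ω, hA, hωH, hω⟩, hA⟩
      · exact Or.inr ht
    calc P (f ⁻¹' H m) ≤ _ := measure_mono_ae hsub
      _ ≤ _ := measure_union_le _ _
      _ ≤ _ := add_le_add (measure_biUnion_finset_le _ _)
        ((hhit _ (measurableSet_markTail K η J)).trans hJ.le)
  refine hupper.trans (add_le_add ?_ le_rfl)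
  have hlim : Tendsto (fun n => ∑ A ∈ 𝒜, P' n (hitPattern (R' n) (V A) (markCell K η) A)) atTop
      (𝓝 (∑ A ∈ 𝒜, P (hitPattern R (V A) (markCell K η) A))) :=
    tendsto_finsetSum _ fun A _ => tendsto_measure_hitPattern hR hR' hvoid
      (measurableSet_markCell K η)
      (fun j => (measure_mono (markCell_subset_markExceed K η j)).trans_lt (hν K η hK hη)) A
      _ (hVm A) (hVν A)
  rw [← hlim.liminf_eq]
  refine liminf_le_liminf (Eventually.of_forall fun n => ?_)
  -- Distinct patterns are incompatible, so the sum is the probability of a union, which lies almost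
  -- surely in `f' n ⁻¹' G`.
  rw [← measure_biUnion_finset]
  · refine measure_mono_ae ?_
    filter_upwards [hf' n] with ω hω hωA
    obtain ⟨A, hA, hωA⟩ := mem_iUnion₂.1 hωA
    obtain ⟨ω₀, hω₀A, hω₀H, hω₀⟩ := (Finset.mem_filter.1 hA).2
    refine hω₀H fun t ht => ?_
    rw [← hηm]
    exact abs_sub_le_of_stormMax_le (hf0 ω₀ t) (hf'0 n ω t) (by positivity) (hω₀ t) (hω t)
      (stormMax_le_of_hits hK hη (hkey hω₀A.1 hωA.2) ht)
      (stormMax_le_of_hits hK hη (hkey hωA.1 hω₀A.2) ht)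
  · intro A hA B hB hAB
    refine disjoint_left.2 fun ω hωA hωB => hAB ?_
    have hsub : ∀ {A B : Finset ℕ}, A ∈ 𝒜 → ω ∈ hitPattern (R' n) (V A) (markCell K η) A →
        ω ∈ hitPattern (R' n) (V B) (markCell K η) B → A ⊆ B := by
      intro A B hA hωA hωB j hj
      by_contra hjB
      refine hωA.2 j hj (hωB.1.mono_right fun z hz => Or.inr (mem_iUnion₂.2 ⟨j, ?_, hz⟩))
      exact Finset.mem_sdiff.2 ⟨Finset.mem_powerset.1 (Finset.mem_filter.1 hA).1 hj, hjB⟩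
    exact (hsub hA hωA hωB).antisymm (hsub hB hωB hωA)
  · exact fun A _ => measurableSet_hitPattern (hR' n) (hVm A) (measurableSet_markCell K η) A

end RandomMarks

/-! ### The intensity measures -/

section Intensity

variable {d : ℕ}

/-- The measure `u⁻² du` on `(0, ∞)`. -/
def severity : Measure ℝ :=
  ((volume : Measure ℝ).restrict (Ioi 0)).withDensity (fun u => ENNReal.ofReal (u ^ 2)⁻¹)

instance : SFinite severity := by unfold severity; infer_instance

/-- The measure `ds × u⁻² du × P_X(dx)`. -/
def baseIntensity (PX : Measure (Path d)) : Measure (Mark d) :=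
  (volume : Measure (Space d)).prod (severity.prod PX)

instance (PX : Measure (Path d)) [SFinite PX] : SFinite (baseIntensity PX) := by
  unfold baseIntensity; infer_instance

lemma severity_apply {A : Set ℝ} (hA : MeasurableSet A) :
    severity A = ∫⁻ u, (A ∩ Ioi 0).indicator (fun u => ENNReal.ofReal (u ^ 2)⁻¹) u := by
  rw [severity, withDensity_apply _ hA, Measure.restrict_restrict hA,
    lintegral_indicator (hA.inter measurableSet_Ioi)]

lemma severity_Iic_zero : severity (Iic 0) = 0 := by
  rw [severity_apply measurableSet_Iic]
  simp

lemma severity_Ioi {a : ℝ} (ha : 0 < a) : severity (Ioi a) = ENNReal.ofReal a⁻¹ := by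
  have hfun : EqOn (fun u : ℝ => (u ^ 2)⁻¹) (fun u => u ^ (-2 : ℝ)) (Ioi a) := fun u hu => by
    have hu0 : 0 < u := ha.trans hu
    simp only
    rw [Real.rpow_neg hu0.le]
    norm_num
  rw [severity_apply measurableSet_Ioi, inter_eq_left.2 (Ioi_subset_Ioi ha.le),
    lintegral_indicator measurableSet_Ioi, ← ofReal_integral_eq_lintegral_ofReal,
    setIntegral_congr_fun measurableSet_Ioi hfun, integral_Ioi_rpow_of_lt (by norm_num) ha]
  · congr 1
    norm_num
    rw [Real.rpow_neg_one]
  · exact (integrableOn_Ioi_rpow_of_lt (by norm_num) ha).congr_fun hfun.symm measurableSet_Ioi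
  · exact ae_of_all _ fun u => by positivity

/-- Substituting `v = c u` gives a factor `c²` from the density and `c⁻¹` from Lebesgue measure.
This homogeneity is what makes normalization by `n` correct. -/
lemma map_mul_severity {c : ℝ} (hc : 0 < c) :
    severity.map (c * ·) = ENNReal.ofReal c • severity := by
  ext A hA
  have hm : Measurable fun u : ℝ => c * u := measurable_const_mul c
  rw [Measure.map_apply hm hA, severity_apply (hm hA), Measure.smul_apply, severity_apply hA]
  set g : ℝ → ℝ≥0∞ := (A ∩ Ioi 0).indicator fun u => ENNReal.ofReal (u ^ 2)⁻¹ with hg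
  have hgm : Measurable g := by
    refine Measurable.indicator ?_ (hA.inter measurableSet_Ioi)
    fun_prop
  have h1 : ∀ u, ((fun u => c * u) ⁻¹' A ∩ Ioi 0).indicator
      (fun u => ENNReal.ofReal (u ^ 2)⁻¹) u = ENNReal.ofReal (c ^ 2) * g (c * u) := by
    intro u
    have hmem : c * u ∈ A ∩ Ioi 0 ↔ u ∈ (fun u => c * u) ⁻¹' A ∩ Ioi 0 := by
      simp [hc]
    by_cases hu : u ∈ (fun u => c * u) ⁻¹' A ∩ Ioi 0
    · rw [hg, indicator_of_mem hu, indicator_of_mem (hmem.2 hu),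
        ← ENNReal.ofReal_mul (by positivity)]
      congr 1
      field_simp
    · rw [hg, indicator_of_notMem hu, indicator_of_notMem (fun h => hu (hmem.1 h)), mul_zero]
  simp only [h1]
  rw [lintegral_const_mul (f := fun u => g (c * u)) _ (hgm.comp hm), ← lintegral_map hgm hm,
    Real.map_volume_mul_left hc.ne', lintegral_smul_measure, smul_eq_mul, smul_eq_mul, ← mul_assoc,
    ← ENNReal.ofReal_mul (by positivity), abs_of_pos (inv_pos.2 hc)]
  congr 2
  field_simp

/-- Multiplication of the severity of a mark by a constant. -/
def scaleMark (c : ℝ) : Mark d → Mark d := Prod.map id (Prod.map (c * ·) id)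

lemma measurable_scaleMark (c : ℝ) : Measurable (scaleMark (d := d) c) :=
  measurable_id.prodMap ((measurable_const_mul c).prodMap measurable_id)

lemma stormShape_scaleMark (c : ℝ) (z : Mark d) (t : Space d) :
    stormShape (scaleMark c z) t = c * stormShape z t := by
  simp [stormShape_apply, scaleMark, mul_assoc]

lemma stormIntensity_preimage_scaleMark (μ : ℝ) (ψ : Space d → ℝ) (PX : Measure (Path d))
    [SFinite PX] {c : ℝ} (hc : 0 < c) {D : Set (Mark d)} (hD : MeasurableSet D) :
    stormIntensity μ ψ PX (scaleMark c ⁻¹' D) = ENNReal.ofReal c * stormIntensity μ ψ PX D := by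
  have key : (stormIntensity μ ψ PX).map (scaleMark c) =
      ENNReal.ofReal c • stormIntensity μ ψ PX := by
    change (ENNReal.ofReal μ⁻¹ • (Measure.prod _ (severity.prod PX))).map _ =
      _ • ENNReal.ofReal μ⁻¹ • (Measure.prod _ (severity.prod PX))
    rw [Measure.map_smul, scaleMark, ← Measure.map_prod_map _ _ measurable_id
      ((measurable_const_mul c).prodMap measurable_id),
      ← Measure.map_prod_map _ _ (measurable_const_mul c) measurable_id, map_mul_severity hc,
      Measure.map_id, Measure.map_id, Measure.prod_smul_left, Measure.prod_smul_right, smul_comm]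
  rw [← Measure.map_apply (measurable_scaleMark c) hD, key, Measure.smul_apply, smul_eq_mul]

/-- With `M` the supremum of the positive part of the shifted storm, a severity `u > 0` can exceed
`η` only if `u > η / M`, a set of measure `M / η`. The cases `M = ∞` and `M = 0` are separate
because of the division. -/
lemma severity_le (x : Path d) (K : Set (Space d)) (s : Space d) {η : ℝ} (hη : 0 < η) :
    severity {u | ∃ t ∈ K, η < u * x (t - s)} ≤
      (⨆ t ∈ K, ENNReal.ofReal (x (t - s))) * (ENNReal.ofReal η)⁻¹ := by
  set M := ⨆ t ∈ K, ENNReal.ofReal (x (t - s)) with hM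
  have hle : ∀ t ∈ K, ENNReal.ofReal (x (t - s)) ≤ M := fun t ht =>
    le_iSup₂ (f := fun t (_ : t ∈ K) => ENNReal.ofReal (x (t - s))) t ht
  rcases eq_or_ne M ∞ with htop | htop
  · rw [htop, ENNReal.top_mul (by simp)]; exact le_top
  have hxt : ∀ t ∈ K, x (t - s) ≤ M.toReal := fun t ht =>
    (Real.le_coe_toNNReal _).trans (ENNReal.toReal_mono htop (hle t ht))
  rcases eq_or_ne M.toReal 0 with h0 | h0
  · have hsub : {u | ∃ t ∈ K, η < u * x (t - s)} ⊆ Iic 0 := by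
      rintro u ⟨t, ht, hu⟩
      by_contra hn
      have h1 := hxt t ht
      rw [h0] at h1
      have := mul_nonpos_of_nonneg_of_nonpos (not_le.1 hn).le h1
      linarith
    exact (measure_mono hsub).trans (severity_Iic_zero.le.trans zero_le)
  have hpos : 0 < M.toReal := lt_of_le_of_ne ENNReal.toReal_nonneg h0.symm
  calc severity {u | ∃ t ∈ K, η < u * x (t - s)}
      ≤ severity (Iic 0 ∪ Ioi (η / M.toReal)) := by
        refine measure_mono fun u ⟨t, ht, hu⟩ => ?_
        rcases le_or_gt u 0 with hu0 | hu0
        · exact Or.inl hu0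
        · refine Or.inr ((div_lt_iff₀ hpos).2 (hu.trans_le ?_))
          exact mul_le_mul_of_nonneg_left (hxt t ht) hu0.le
    _ ≤ severity (Iic 0) + severity (Ioi (η / M.toReal)) := measure_union_le _ _
    _ = M * (ENNReal.ofReal η)⁻¹ := by
        rw [severity_Iic_zero, zero_add, severity_Ioi (by positivity), inv_div, div_eq_mul_inv,
          ENNReal.ofReal_mul hpos.le, ENNReal.ofReal_toReal htop, ENNReal.ofReal_inv_of_pos hη]

lemma baseIntensity_le {PX : Measure (Path d)} [SFinite PX] {E : Set (Mark d)}
    (hE : MeasurableSet E) {M : Path d → Space d → ℝ≥0∞}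
    (hM : Measurable fun q : Path d × Space d => M q.1 q.2) (C : ℝ≥0∞)
    (h : ∀ x s, severity {u | (s, u, x) ∈ E} ≤ M x s * C) :
    baseIntensity PX E ≤ (∫⁻ x, ∫⁻ s, M x s ∂volume ∂PX) * C := by
  have hM' : Measurable fun q : Space d × Path d => M q.2 q.1 := hM.comp measurable_swap
  calc baseIntensity PX E
      = ∫⁻ s, ∫⁻ x, severity {u | (s, u, x) ∈ E} ∂PX := by
        rw [baseIntensity, Measure.prod_apply hE]
        refine lintegral_congr fun s => ?_
        rw [Measure.prod_apply_symm (measurable_prodMk_left hE)]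
        rfl
    _ ≤ ∫⁻ s, ∫⁻ x, M x s * C ∂PX := lintegral_mono fun s => lintegral_mono fun x => h x s
    _ = ∫⁻ s, (∫⁻ x, M x s ∂PX) * C :=
        lintegral_congr fun s => lintegral_mul_const _ (hM'.comp measurable_prodMk_left)
    _ = (∫⁻ s, ∫⁻ x, M x s ∂PX) * C := lintegral_mul_const _ hM'.lintegral_prod_right'
    _ = (∫⁻ x, ∫⁻ s, M x s ∂volume ∂PX) * C := by
        rw [lintegral_lintegral_swap hM'.aemeasurable]

lemma baseIntensity_markExceed_lt_top {PX : Measure (Path d)} [SFinite PX]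
    (hX : StormIntegrable PX) {K : Set (Space d)} (hK : IsCompact K) {η : ℝ} (hη : 0 < η) :
    baseIntensity PX (markExceed K η) < ∞ := by
  refine (baseIntensity_le (measurableSet_markExceed K η)
    (M := fun x s => ⨆ t ∈ K, ENNReal.ofReal (x (t - s))) ?_ (ENNReal.ofReal η)⁻¹
    fun x s => severity_le x K s hη).trans_lt ?_
  -- A supremum over the possibly uncountable `K` of jointly continuous functions is lower
  -- semicontinuous, hence measurable.
  · refine LowerSemicontinuous.measurable (lowerSemicontinuous_biSup fun t _ => ?_)
    refine Continuous.lowerSemicontinuous (ENNReal.continuous_ofReal.comp ?_)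
    fun_prop
  · exact ENNReal.mul_lt_top (hX K hK) (by simp [hη])

lemma stormIntensity_apply (μ : ℝ) {ψ : Space d → ℝ} (hψ : Measurable ψ) (PX : Measure (Path d))
    [SFinite PX] {D : Set (Mark d)} (hD : MeasurableSet D) :
    stormIntensity μ ψ PX D =
      ENNReal.ofReal μ⁻¹ * ∫⁻ z in D, ENNReal.ofReal (ψ z.1) ∂baseIntensity PX := by
  change (ENNReal.ofReal μ⁻¹ • (Measure.prod _ (severity.prod PX))) D = _
  rw [Measure.smul_apply, prod_withDensity_left hψ.ennreal_ofReal, withDensity_apply _ hD]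
  rfl

lemma stormIntensity_one (μ : ℝ) (PX : Measure (Path d)) [SFinite PX] :
    stormIntensity μ (fun _ => 1) PX = ENNReal.ofReal μ⁻¹ • baseIntensity PX := by
  ext D hD
  rw [stormIntensity_apply _ measurable_const PX hD]
  simp

variable {Ω : Type*} [MeasurableSpace Ω]

lemma lintegral_stationary {P : Measure Ω} {Psi : Ω → Path d} (hstat : IsStationary Psi P)
    (s : Space d) :
    ∫⁻ ω, ENNReal.ofReal (Psi ω s) ∂P = ∫⁻ ω, ENNReal.ofReal (Psi ω 0) ∂P := by
  have h := (hstat s 1 fun _ => 0).comp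
    (u := fun v : Fin 1 → ℝ => ENNReal.ofReal (v 0)) (by fun_prop)
  simpa [Function.comp_def] using h.lintegral_eq

lemma measurable_path_eval {Psi : Ω → Path d} (hPsi : Measurable Psi) :
    Measurable fun q : Ω × Space d => Psi q.1 q.2 := by
  have h : Measurable fun q : Path d × Space d => q.1 q.2 :=
    (by fun_prop : Continuous fun q : Path d × Space d => q.1 q.2).measurable
  exact h.comp (hPsi.prodMap measurable_id)

/-- By Tonelli the mean may be taken inside the integral over marks, where stationarity makes it
independent of the storm centre. -/
lemma lintegral_stormIntensity {P : Measure Ω} [SFinite P] {Psi : Ω → Path d}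
    (hPsi : Measurable Psi) (hstat : IsStationary Psi P) (μ : ℝ) (PX : Measure (Path d))
    [SFinite PX] {D : Set (Mark d)} (hD : MeasurableSet D) :
    ∫⁻ ω, stormIntensity μ (Psi ω) PX D ∂P =
      ENNReal.ofReal μ⁻¹ * (∫⁻ ω, ENNReal.ofReal (Psi ω 0) ∂P) * baseIntensity PX D := by
  have hm : Measurable fun q : Ω × Mark d => ENNReal.ofReal (Psi q.1 q.2.1) :=
    ((measurable_path_eval hPsi).comp
      (measurable_fst.prodMk (measurable_fst.comp measurable_snd))).ennreal_ofReal
  simp only [fun ω => stormIntensity_apply μ (Psi ω).continuous.measurable PX hD]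
  rw [lintegral_const_mul _ hm.lintegral_prod_right', lintegral_lintegral_swap hm.aemeasurable]
  simp only [lintegral_stationary hstat]
  rw [setLIntegral_const, mul_assoc]

end Intensity

/-! ### Void probabilities -/

section Void

variable {Ω S : Type*} [MeasurableSpace Ω] [MeasurableSpace S]

lemma pointMeasure_eq_zero_iff {Ω : Type*} {p : ℕ → Ω → S} {ω : Ω} {D : Set S} (hD : MeasurableSet D) :
    pointMeasure p ω D = 0 ↔ Disjoint (range fun i => p i ω) D := by
  rw [pointMeasure, Measure.sum_apply _ hD, ENNReal.tsum_eq_zero, disjoint_left, forall_mem_range]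
  refine forall_congr' fun i => ?_
  rw [Measure.dirac_apply' _ hD]
  by_cases h : p i ω ∈ D <;> simp [h]

lemma measurableSet_disjoint_range {p : ℕ → Ω → S} (hp : ∀ i, Measurable (p i)) {D : Set S}
    (hD : MeasurableSet D) : MeasurableSet {ω | Disjoint (range fun i => p i ω) D} := by
  have : {ω | Disjoint (range fun i => p i ω) D} = ⋂ i, p i ⁻¹' Dᶜ := by
    ext ω
    simp [disjoint_left]
  rw [this]
  exact MeasurableSet.iInter fun i => hp i hD.compl

lemma IsPoissonProcess.measure_void {p : ℕ → Ω → S} {lam : Measure S} {P : Measure Ω}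
    (h : IsPoissonProcess (pointMeasure p) lam P) {D : Set S} (hD : MeasurableSet D)
    (hfin : lam D < ∞) :
    P {ω | Disjoint (range fun i => p i ω) D} = ENNReal.ofReal (Real.exp (-(lam D).toReal)) := by
  have h1 : P.map (fun ω => pointMeasure p ω D) {0} =
      (poissonMeasure (lam D).toNNReal).map (fun n : ℕ => (n : ℝ≥0∞)) {0} := by
    rw [h.law_count D hD hfin]
  have hm : Measurable fun ω => pointMeasure p ω D :=
    (Measure.measurable_coe hD).comp h.measurable_process
  have hpre : (fun n : ℕ => (n : ℝ≥0∞)) ⁻¹' {0} = {0} := by ext n; simp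
  rw [Measure.map_apply hm (measurableSet_singleton 0),
    Measure.map_apply measurable_from_top (measurableSet_singleton 0), hpre,
    poissonMeasure_singleton] at h1
  simp only [preimage, mem_singleton_iff, pointMeasure_eq_zero_iff hD] at h1
  rw [h1]
  simp [ENNReal.coe_toNNReal_eq_toReal]

lemma IsCoxProcess.measureReal_void {p : ℕ → Ω → S} {Lam : Ω → Measure S} {P : Measure Ω}
    [IsProbabilityMeasure P] (h : IsCoxProcess (pointMeasure p) Lam P) (hp : ∀ i, Measurable (p i))
    {D : Set S} (hD : MeasurableSet D) (hfin : ∀ᵐ ω ∂P, Lam ω D < ∞) :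
    P.real {ω | Disjoint (range fun i => p i ω) D} = ∫ ω, Real.exp (-(Lam ω D).toReal) ∂P := by
  -- A single set and the count `0`: the conditional void probability, whose mean is then taken.
  have h1 := h.cond_count 1 (fun _ => D) (fun _ => hD)
    (fun i j hij => absurd (Subsingleton.elim i j) hij) (fun _ => 0)
  have hset : {ω | ∀ _ : Fin 1, pointMeasure p ω D = ((0 : ℕ) : ℝ≥0∞)} =
      {ω | Disjoint (range fun i => p i ω) D} := by
    ext ω
    simp [pointMeasure_eq_zero_iff hD]
  rw [hset] at h1
  rw [← integral_condExp_indicator h.measurable_directing (measurableSet_disjoint_range hp hD)]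
  refine integral_congr_ae ?_
  filter_upwards [h1, hfin] with ω hω hωD
  rw [hω fun _ => hωD]
  simp

lemma one_sub_exp_neg_le (x : ℝ) : 1 - Real.exp (-x) ≤ x := by
  linarith [Real.add_one_le_exp (-x)]

lemma measure_hit_eq {S : Type*} {P : Measure Ω} [IsProbabilityMeasure P] {R : Ω → Set S} {D : Set S}
    (hR : MeasurableSet {ω | Disjoint (R ω) D}) :
    P {ω | ¬ Disjoint (R ω) D} = ENNReal.ofReal (1 - P.real {ω | Disjoint (R ω) D}) := by
  rw [← probReal_compl_eq_one_sub hR, ofReal_measureReal]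
  rfl

lemma IsPoissonProcess.measure_hit_le {p : ℕ → Ω → S} {lam : Measure S} {P : Measure Ω}
    [IsProbabilityMeasure P] (h : IsPoissonProcess (pointMeasure p) lam P)
    (hp : ∀ i, Measurable (p i)) {D : Set S} (hD : MeasurableSet D) :
    P {ω | ¬ Disjoint (range fun i => p i ω) D} ≤ lam D := by
  rcases eq_or_ne (lam D) ∞ with htop | htop
  · rw [htop]; exact le_top
  rw [measure_hit_eq (measurableSet_disjoint_range hp hD), measureReal_def,
    h.measure_void hD htop.lt_top, ENNReal.toReal_ofReal (Real.exp_pos _).le]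
  exact (ENNReal.ofReal_le_ofReal (one_sub_exp_neg_le _)).trans (ENNReal.ofReal_toReal htop).le

lemma IsCoxProcess.measure_hit_le {p : ℕ → Ω → S} {Lam : Ω → Measure S} {P : Measure Ω}
    [IsProbabilityMeasure P] (h : IsCoxProcess (pointMeasure p) Lam P) (hp : ∀ i, Measurable (p i))
    {D : Set S} (hD : MeasurableSet D) :
    P {ω | ¬ Disjoint (range fun i => p i ω) D} ≤ ∫⁻ ω, Lam ω D ∂P := by
  have hm : Measurable fun ω => Lam ω D :=
    (Measure.measurable_coe hD).comp h.measurable_directing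
  rcases eq_or_ne (∫⁻ ω, Lam ω D ∂P) ∞ with htop | htop
  · rw [htop]; exact le_top
  have hfin := ae_lt_top hm htop
  have hint : Integrable (fun ω => (Lam ω D).toReal) P :=
    integrable_toReal_of_lintegral_ne_top hm.aemeasurable htop
  have hexp : Integrable (fun ω => Real.exp (-(Lam ω D).toReal)) P := by
    refine Integrable.of_bound (C := 1) hm.ennreal_toReal.neg.exp.aestronglyMeasurable
      (ae_of_all _ fun ω => ?_)
    rw [Real.norm_eq_abs, Real.abs_exp]
    exact Real.exp_le_one_iff.2 (neg_nonpos.2 ENNReal.toReal_nonneg)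
  rw [measure_hit_eq (measurableSet_disjoint_range hp hD), h.measureReal_void hp hD hfin]
  have h1 : 1 - ∫ ω, Real.exp (-(Lam ω D).toReal) ∂P ≤ ∫ ω, (Lam ω D).toReal ∂P := by
    have := integral_mono ((integrable_const (1 : ℝ)).sub hexp) hint
      (fun ω => one_sub_exp_neg_le (Lam ω D).toReal)
    rw [integral_sub' (integrable_const _) hexp] at this
    simpa using this
  refine (ENNReal.ofReal_le_ofReal h1).trans ?_
  rw [integral_toReal hm.aemeasurable hfin, ENNReal.ofReal_toReal htop]

/-- It suffices that `n (E exp(-W/n) - 1) → -E W`. Pointwise this is the derivative of `s ↦ exp(-s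
W)` at `0`, and `W` dominates. -/
lemma tendsto_integral_exp_pow {P : Measure Ω} [IsProbabilityMeasure P] {W : Ω → ℝ}
    (hW : Integrable W P) (hW0 : ∀ ω, 0 ≤ W ω) :
    Tendsto (fun n : ℕ => (∫ ω, Real.exp (-((1 / (n : ℝ)) * W ω)) ∂P) ^ n) atTop
      (𝓝 (Real.exp (-∫ ω, W ω ∂P))) := by
  have hmeas : ∀ n : ℕ, AEStronglyMeasurable (fun ω => Real.exp (-((1 / (n : ℝ)) * W ω))) P :=
    fun n => Real.continuous_exp.comp_aestronglyMeasurable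
      (hW.aestronglyMeasurable.const_mul _).neg
  have hexp : ∀ n : ℕ, Integrable (fun ω => Real.exp (-((1 / (n : ℝ)) * W ω))) P := by
    refine fun n => Integrable.of_bound (C := 1) (hmeas n) (ae_of_all _ fun ω => ?_)
    rw [Real.norm_eq_abs, Real.abs_exp]
    exact Real.exp_le_one_iff.2 (neg_nonpos.2 (mul_nonneg (by positivity) (hW0 ω)))
  have hlim : Tendsto (fun n : ℕ => ∫ ω, (n : ℝ) * (Real.exp (-((1 / (n : ℝ)) * W ω)) - 1) ∂P)
      atTop (𝓝 (∫ ω, -W ω ∂P)) := by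
    refine tendsto_integral_of_dominated_convergence W
      (fun n => ((hmeas n).sub aestronglyMeasurable_const).const_mul _) hW
      (fun n => ae_of_all _ fun ω => ?_) (ae_of_all _ fun ω => ?_)
    · have h0 : 0 ≤ 1 / (n : ℝ) * W ω := mul_nonneg (by positivity) (hW0 ω)
      have h1 := one_sub_exp_neg_le (1 / (n : ℝ) * W ω)
      have h2 : Real.exp (-(1 / (n : ℝ) * W ω)) ≤ 1 := Real.exp_le_one_iff.2 (neg_nonpos.2 h0)
      rw [Real.norm_eq_abs, abs_mul, abs_of_nonneg n.cast_nonneg, abs_sub_comm,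
        abs_of_nonneg (sub_nonneg.2 h2)]
      refine (mul_le_mul_of_nonneg_left h1 n.cast_nonneg).trans ?_
      rw [← mul_assoc, mul_one_div]
      -- The inequality `n / n ≤ 1` also covers `n = 0`, where the quotient is `0`.
      exact mul_le_of_le_one_left (hW0 ω) (div_self_le_one _)
    · have hd : HasDerivAt (fun s : ℝ => Real.exp (-(s * W ω))) (-W ω) 0 := by
        have := (((hasDerivAt_id (0 : ℝ)).mul_const (W ω)).neg).exp
        simpa using this
      have hs : Tendsto (fun n : ℕ => 1 / (n : ℝ)) atTop (𝓝[≠] 0) := by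
        refine tendsto_nhdsWithin_iff.2 ⟨tendsto_one_div_atTop_nhds_zero_nat, ?_⟩
        filter_upwards [eventually_gt_atTop 0] with n hn
        have : (0 : ℝ) < n := by exact_mod_cast hn
        simp [this.ne']
      have := hd.tendsto_slope_zero.comp hs
      simpa [Function.comp_def] using this
  rw [integral_neg] at hlim
  have hg : Tendsto (fun n : ℕ => (n : ℝ) * ((∫ ω, Real.exp (-((1 / (n : ℝ)) * W ω)) ∂P) - 1))
      atTop (𝓝 (-∫ ω, W ω ∂P)) := by
    refine hlim.congr fun n => ?_
    rw [integral_const_mul, integral_sub (hexp n) (integrable_const _)]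
    simp
  simpa using Real.tendsto_one_add_pow_exp_of_tendsto hg

end Void

/-! ### Maxima of independent copies -/

section Copies

variable {d : ℕ} {Ω : Type*}

/-- The pointwise maximum of `n + 1` functions. -/
def finMax (n : ℕ) (v : Fin (n + 1) → Path d) : Path d :=
  Finset.univ.sup' Finset.univ_nonempty v

lemma finMax_apply (n : ℕ) (v : Fin (n + 1) → Path d) (t : Space d) :
    finMax n v t = Finset.univ.sup' Finset.univ_nonempty fun i => v i t :=
  ContinuousMap.sup'_apply _ _ _

lemma measurable_finMax (n : ℕ) : Measurable (finMax (d := d) n) := by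
  refine measurable_path_of_eval fun t => ?_
  simp only [finMax_apply]
  have := Finset.measurable_sup' (f := fun i (v : Fin (n + 1) → Path d) => v i t)
    Finset.univ_nonempty fun i _ =>
      (continuous_eval_const (F := Path d) t).measurable.comp (measurable_pi_apply i)
  convert this using 1
  ext v
  rw [Finset.sup'_apply]

lemma maxFirst_eq_finMax (Yc : ℕ → Ω → Path d) (n : ℕ) (ω : Ω) :
    maxFirst Yc n ω = finMax n fun i => Yc i ω := by
  refine le_antisymm (Finset.sup'_le _ _ fun i hi => ?_) (Finset.sup'_le _ _ fun i _ => ?_)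
  · exact Finset.le_sup' (fun i : Fin (n + 1) => Yc i ω)
      (Finset.mem_univ ⟨i, Finset.mem_range.1 hi⟩)
  · exact Finset.le_sup' (fun i => Yc i ω) (Finset.mem_range.2 i.2)

lemma ofReal_finMax (n : ℕ) (v : Fin (n + 1) → Path d) (t : Space d) :
    ENNReal.ofReal (finMax n v t) = ⨆ i, ENNReal.ofReal (v i t) := by
  rw [finMax_apply]
  refine le_antisymm ?_ (iSup_le fun i => ENNReal.ofReal_le_ofReal
    (Finset.le_sup' (fun i => v i t) (Finset.mem_univ i)))
  obtain ⟨i, -, hi⟩ := Finset.exists_mem_eq_sup' Finset.univ_nonempty fun i => v i t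
  rw [hi]
  exact le_iSup (fun i => ENNReal.ofReal (v i t)) i

lemma finMax_nonneg (n : ℕ) {v : Fin (n + 1) → Path d} {t : Space d} (h : ∀ i, 0 ≤ v i t) :
    0 ≤ finMax n v t := by
  rw [finMax_apply]
  exact (h 0).trans (Finset.le_sup' (fun i => v i t) (Finset.mem_univ 0))

lemma stormMax_iUnion {ι : Type*} (R : ι → Set (Mark d)) (t : Space d) :
    stormMax (⋃ i, R i) t = ⨆ i, stormMax (R i) t := by
  simp only [stormMax, iSup_iUnion]

lemma stormMax_scaleMark {c : ℝ} (hc : 0 ≤ c) (R : Set (Mark d)) (t : Space d) :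
    stormMax (scaleMark c '' R) t = ENNReal.ofReal c * stormMax R t := by
  simp only [stormMax, iSup_image, stormShape_scaleMark, ENNReal.ofReal_mul hc, ENNReal.mul_iSup]

variable [MeasurableSpace Ω]

/-- The copies `Yc` carry no point processes. Only their joint law matters, so they are realised on
`Ωⁿ⁺¹`, where each coordinate has its own marks. -/
lemma measure_maxFirst_preimage {Ω' : Type*} [MeasurableSpace Ω'] {P : Measure Ω}
    [IsProbabilityMeasure P] {P' : Measure Ω'} [IsProbabilityMeasure P'] {Y : Ω → Path d}
    {Yc : ℕ → Ω' → Path d} (h : AreIIDCopies Yc P' Y P) (n : ℕ) {A : Set (Path d)}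
    (hA : MeasurableSet A) :
    P' {ω | maxFirst Yc n ω ∈ A} =
      Measure.pi (fun _ : Fin (n + 1) => P) {ω | finMax n (fun i => Y (ω i)) ∈ A} := by
  have hind : iIndepFun (fun i : Fin (n + 1) => Yc i) P' := h.1.precomp Fin.val_injective
  have hY : AEMeasurable Y P := (h.2 0).aemeasurable_snd
  have hYc : ∀ i : Fin (n + 1), AEMeasurable (Yc i) P' := fun i => (h.2 i).aemeasurable_fst
  have : IsProbabilityMeasure (P.map Y) := Measure.isProbabilityMeasure_map hY
  have e1 := (iIndepFun_iff_map_fun_eq_pi_map hYc).1 hind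
  have e2 := Measure.pi_map_pi (μ := fun _ : Fin (n + 1) => P) (f := fun _ => Y) (fun _ => hY)
  have e3 : P'.map (fun ω (i : Fin (n + 1)) => Yc i ω) =
      (Measure.pi fun _ : Fin (n + 1) => P).map fun ω i => Y (ω i) := by
    rw [e1, e2]
    congr 1
    ext1 i
    exact (h.2 i).map_eq
  have hT := measurable_finMax (d := d) n hA
  have hYpi : AEMeasurable (fun (ω : Fin (n + 1) → Ω) i => Y (ω i)) (Measure.pi fun _ => P) :=
    aemeasurable_pi_lambda _ fun i =>
      hY.comp_quasiMeasurePreserving (Measure.quasiMeasurePreserving_eval _ i)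
  have h1 : P'.map (fun ω (i : Fin (n + 1)) => Yc i ω) (finMax n ⁻¹' A) =
      (Measure.pi fun _ : Fin (n + 1) => P).map (fun ω i => Y (ω i)) (finMax n ⁻¹' A) := by
    rw [e3]
  rw [Measure.map_apply_of_aemeasurable (aemeasurable_pi_lambda _ hYc) hT,
    Measure.map_apply_of_aemeasurable hYpi hT] at h1
  simp only [maxFirst_eq_finMax]
  exact h1

end Copies

/-! ### The max-domain of attraction -/

section Attraction

variable {d : ℕ} {Ω ΩZ : Type*} [MeasurableSpace Ω] [MeasurableSpace ΩZ]

/-- The void probabilities of the superposition of `n` independent copies of a Cox process whose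
intensity is reduced by the factor `c / n`. -/
lemma tendsto_void_superposition {P : Measure Ω} [IsProbabilityMeasure P] {Psi : Ω → Path d}
    {PX : Measure (Path d)} [IsProbabilityMeasure PX] {μ : ℝ} {p : ℕ → Ω → Mark d}
    (hp : ∀ i, Measurable (p i))
    (hCox : IsCoxProcess (pointMeasure p) (fun ω => stormIntensity μ (Psi ω) PX) P)
    {c : ℝ} (hc : 0 < c) {D : Set (Mark d)} (hD : MeasurableSet D)
    (hfin : ∫⁻ ω, stormIntensity μ (Psi ω) PX D ∂P ≠ ∞) :
    Tendsto (fun n : ℕ => P {ω | Disjoint (range fun k => p k ω)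
        (scaleMark (c / ((n : ℝ) + 1)) ⁻¹' D)} ^ (n + 1)) atTop
      (𝓝 (ENNReal.ofReal (Real.exp
        (-(ENNReal.ofReal c * ∫⁻ ω, stormIntensity μ (Psi ω) PX D ∂P).toReal)))) := by
  have hm : Measurable fun ω => stormIntensity μ (Psi ω) PX D :=
    (Measure.measurable_coe hD).comp hCox.measurable_directing
  have hae := ae_lt_top hm hfin
  set W : Ω → ℝ := fun ω => c * (stormIntensity μ (Psi ω) PX D).toReal with hWdef
  have hW : Integrable W P :=
    (integrable_toReal_of_lintegral_ne_top hm.aemeasurable hfin).const_mul c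
  have hW0 : ∀ ω, 0 ≤ W ω := fun ω => mul_nonneg hc.le ENNReal.toReal_nonneg
  have hWint : ∫ ω, W ω ∂P =
      (ENNReal.ofReal c * ∫⁻ ω, stormIntensity μ (Psi ω) PX D ∂P).toReal := by
    rw [integral_const_mul, integral_toReal hm.aemeasurable hae, ENNReal.toReal_mul,
      ENNReal.toReal_ofReal hc.le]
  rw [← hWint]
  have hlim := (tendsto_integral_exp_pow hW hW0).comp (tendsto_add_atTop_nat 1)
  refine ((ENNReal.continuous_ofReal.tendsto _).comp hlim).congr fun n => ?_
  have hcn : 0 < c / ((n : ℝ) + 1) := by positivity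
  have hDn := measurable_scaleMark (d := d) (c / ((n : ℝ) + 1)) hD
  have hI : ∀ ω, stormIntensity μ (Psi ω) PX (scaleMark (c / ((n : ℝ) + 1)) ⁻¹' D) =
      ENNReal.ofReal (c / ((n : ℝ) + 1)) * stormIntensity μ (Psi ω) PX D := fun ω =>
    stormIntensity_preimage_scaleMark μ (Psi ω) PX hcn hD
  have hv := hCox.measureReal_void hp hDn (by
    filter_upwards [hae] with ω hω
    rw [hI]
    exact ENNReal.mul_lt_top ENNReal.ofReal_lt_top hω)
  have hv' : P.real {ω | Disjoint (range fun k => p k ω) (scaleMark (c / ((n : ℝ) + 1)) ⁻¹' D)} =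
      ∫ ω, Real.exp (-((1 / ((n + 1 : ℕ) : ℝ)) * W ω)) ∂P := by
    rw [hv]
    refine integral_congr_ae (ae_of_all _ fun ω => ?_)
    simp only [hI, ENNReal.toReal_mul, ENNReal.toReal_ofReal hcn.le, hWdef]
    congr 2
    push_cast
    ring
  simp only [Function.comp_apply]
  rw [← hv', ENNReal.ofReal_pow measureReal_nonneg, ofReal_measureReal]

/-- Avoidance by the superposition is a product event, so its probability is an `(n + 1)`-st power.
-/
lemma disjoint_iUnion_scaleMark_iff {Ω : Type*} (p : ℕ → Ω → Mark d) (c : ℝ) (n : ℕ) (D : Set (Mark d)) :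
    {ω : Fin (n + 1) → Ω | Disjoint (⋃ i, scaleMark c '' range fun k => p k (ω i)) D} =
      univ.pi fun _ => {ω | Disjoint (range fun k => p k ω) (scaleMark c ⁻¹' D)} := by
  ext ω
  refine disjoint_iUnion_left.trans (Iff.trans (forall_congr' fun i => ?_) mem_univ_pi.symm)
  rw [mem_ofPred_eq, disjoint_left, disjoint_left]
  exact ⟨fun h z hz => h ⟨z, hz, rfl⟩, by rintro h _ ⟨z, hz, rfl⟩; exact h hz⟩

/-- Suitably normalized maxima of independent copies of the extremal field of a Cox process
converge weakly to the extremal field of the Poisson process with the mean intensity. -/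
theorem tendstoInDistribution_maxFirst {P : Measure Ω} [IsProbabilityMeasure P]
    {Q : Measure ΩZ} [IsProbabilityMeasure Q] {Psi : Ω → Path d} (hPsi : Measurable Psi)
    (hstat : IsStationary Psi P) {PX : Measure (Path d)} [IsProbabilityMeasure PX]
    (hX : StormIntegrable PX) {muY muZ c : ℝ} (hc : 0 < c)
    (hmean : ENNReal.ofReal c * (ENNReal.ofReal muY⁻¹ * ∫⁻ ω, ENNReal.ofReal (Psi ω 0) ∂P) =
      ENNReal.ofReal muZ⁻¹)
    {pY : ℕ → Ω → Mark d} (hpY : ∀ i, Measurable (pY i))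
    (hCox : IsCoxProcess (pointMeasure pY) (fun ω => stormIntensity muY (Psi ω) PX) P)
    (htY : ∀ᵐ ω ∂P, IsTame (range fun i => pY i ω))
    {pZ : ℕ → ΩZ → Mark d} (hpZ : ∀ i, Measurable (pZ i))
    (hPoisson : IsPoissonProcess (pointMeasure pZ) (stormIntensity muZ (fun _ => 1) PX) Q)
    (htZ : ∀ᵐ ω ∂Q, IsTame (range fun i => pZ i ω))
    {Ω' : Type*} [MeasurableSpace Ω'] {P' : Measure Ω'} [IsProbabilityMeasure P']
    {Yc : ℕ → Ω' → Path d} (hYc : AreIIDCopies Yc P' (fun ω => toPath (extremalField pY ω)) P) :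
    TendstoInDistribution (fun (n : ℕ) ω => (c / ((n : ℝ) + 1)) • maxFirst Yc n ω) atTop
      (fun ω => toPath (extremalField pZ ω)) (fun _ => P') Q := by
  have hsm : ∀ a : ℝ, Measurable fun g : Path d => a • g := fun a =>
    (continuous_const_smul a).measurable
  have hmax : ∀ n : ℕ, AEMeasurable (fun ω => (c / ((n : ℝ) + 1)) • maxFirst Yc n ω) P' := by
    intro n
    simp only [maxFirst_eq_finMax]
    exact (hsm _).comp_aemeasurable ((measurable_finMax n).comp_aemeasurable
      (aemeasurable_pi_lambda _ fun i => (hYc.2 i).aemeasurable_fst))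
  have hZ := aemeasurable_toPath_extremalField hpZ htZ
  refine ⟨hmax, hZ, tendsto_of_forall_isOpen_le_liminf' fun G hG => ?_⟩
  let R' : ∀ n : ℕ, (Fin (n + 1) → Ω) → Set (Mark d) := fun n ω =>
    ⋃ i, scaleMark (c / ((n : ℝ) + 1)) '' range fun k => pY k (ω i)
  let f' : ∀ n : ℕ, (Fin (n + 1) → Ω) → Path d := fun n ω =>
    (c / ((n : ℝ) + 1)) • finMax n fun i => toPath (extremalField pY (ω i))
  have hmain := measure_open_le_liminf_of_void (ν := stormIntensity muZ (fun _ => 1) PX)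
    (P := Q) (R := fun ω => range fun i => pZ i ω)
    (P' := fun n => Measure.pi fun _ : Fin (n + 1) => P) (R' := R') (f' := f')
    (f := fun ω => toPath (extremalField pZ ω))
    (fun D hD => measurableSet_disjoint_range hpZ hD) (fun n D hD => ?_) (fun D hD hDfin => ?_)
    (fun D hD => hPoisson.measure_hit_le hpZ hD) (fun K η hK hη => ?_)
    (fun ω t => toPath_nonneg _ t) ?_ (fun n ω t => ?_) (fun n => ?_) hG
  · refine le_trans (le_of_eq ?_) (hmain.trans (le_of_eq ?_))
    · exact Measure.map_apply_of_aemeasurable hZ hG.measurableSet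
    · congr 1
      ext n
      exact (measure_maxFirst_preimage hYc n (hsm _ hG.measurableSet)).symm.trans
        (Measure.map_apply_of_aemeasurable (hmax n) hG.measurableSet).symm
  · rw [disjoint_iUnion_scaleMark_iff]
    exact MeasurableSet.univ_pi fun _ =>
      measurableSet_disjoint_range hpY (measurable_scaleMark _ hD)
  · have hmeanD : ENNReal.ofReal c * ∫⁻ ω, stormIntensity muY (Psi ω) PX D ∂P =
        stormIntensity muZ (fun _ => 1) PX D := by
      rw [lintegral_stormIntensity hPsi hstat muY PX hD, stormIntensity_one, ← mul_assoc, hmean]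
      rfl
    -- As `c > 0`, an infinite mean would contradict finiteness of the Poisson intensity of `D`.
    have hfin : ∫⁻ ω, stormIntensity muY (Psi ω) PX D ∂P ≠ ∞ := by
      intro htop
      rw [htop, ENNReal.mul_top (by simpa using hc)] at hmeanD
      exact hDfin.ne hmeanD.symm
    have := tendsto_void_superposition hpY hCox hc hD hfin
    rw [hmeanD, ← hPoisson.measure_void hD hDfin] at this
    refine this.congr fun n => ?_
    rw [disjoint_iUnion_scaleMark_iff, Measure.pi_pi]
    simp
  · rw [stormIntensity_one]
    exact ENNReal.mul_lt_top ENNReal.ofReal_lt_top (baseIntensity_markExceed_lt_top hX hK hη)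
  · filter_upwards [htZ] with ω hω t
    rw [extremalField_eq_stormMax]
    exact hω.ofReal_toPath t
  · exact mul_nonneg (by positivity) (finMax_nonneg n fun i => toPath_nonneg _ t)
  · have hall : ∀ᵐ ω ∂Measure.pi (fun _ : Fin (n + 1) => P),
        ∀ i, IsTame (range fun k => pY k (ω i)) := ae_all_iff.2 fun i =>
      (Measure.quasiMeasurePreserving_eval (fun _ : Fin (n + 1) => P) i).ae htY
    filter_upwards [hall] with ω hω t
    have hcn : 0 ≤ c / ((n : ℝ) + 1) := by positivity
    simp only [f', R', ContinuousMap.smul_apply, smul_eq_mul, ENNReal.ofReal_mul hcn,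
      ofReal_finMax, stormMax_iUnion, stormMax_scaleMark hcn, ENNReal.mul_iSup,
      extremalField_eq_stormMax]
    exact iSup_congr fun i => by rw [(hω i).ofReal_toPath t]

end Attraction

end CoxExtremal

end

theorem theorem1 {d : ℕ}
    {Ω ΩZ : Type*} [MeasurableSpace Ω] [MeasurableSpace ΩZ]
    (P : Measure Ω) [IsProbabilityMeasure P] (Q : Measure ΩZ) [IsProbabilityMeasure Q]
    -- the intensity process
    (Psi : Ω → CoxExtremal.Path d) (hPsi_meas : Measurable Psi)
    (hPsi_stat : CoxExtremal.IsStationary Psi P)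
    (hPsi_pos : ∀ᵐ ω ∂P, ∀ s, 0 < Psi ω s)
    (hPsi_int : Integrable (fun ω => Psi ω 0) P)
    -- the law of the storm process
    (PX : Measure (CoxExtremal.Path d)) [IsProbabilityMeasure PX]
    (hX_nonneg : ∀ᵐ x ∂PX, ∀ s, 0 ≤ x s)
    (hX_int : CoxExtremal.StormIntegrable PX) (hX_supp : CoxExtremal.StormSupport PX)
    -- the scaling constants
    (muY muZ : ℝ) (hmuY : 0 < muY) (hmuZ : 0 < muZ)
    -- the points of the Cox process underlying `Y` and of the Poisson process underlying `Z`
    (pY : ℕ → Ω → CoxExtremal.Mark d) (hpY : ∀ i, Measurable (pY i))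
    (hCox : CoxExtremal.IsCoxProcess (CoxExtremal.pointMeasure pY)
      (fun ω => CoxExtremal.stormIntensity muY (Psi ω) PX) P)
    (pZ : ℕ → ΩZ → CoxExtremal.Mark d) (hpZ : ∀ i, Measurable (pZ i))
    (hPoisson : CoxExtremal.IsPoissonProcess (CoxExtremal.pointMeasure pZ)
      (CoxExtremal.stormIntensity muZ (fun _ => 1) PX) Q) :
    CoxExtremal.FiniteAndSampleContinuous (CoxExtremal.extremalField pY) P ∧
    CoxExtremal.FiniteAndSampleContinuous (CoxExtremal.extremalField pZ) Q ∧
    ∀ {Ω' : Type*} [MeasurableSpace Ω'] (P' : Measure Ω') [IsProbabilityMeasure P']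
      (Yc : ℕ → Ω' → CoxExtremal.Path d),
      CoxExtremal.AreIIDCopies Yc P'
        (fun ω => CoxExtremal.toPath (CoxExtremal.extremalField pY ω)) P →
      CoxExtremal.InMaxDomainOfAttraction Yc P'
        (fun ω => CoxExtremal.toPath (CoxExtremal.extremalField pZ ω)) Q ∧
      ∀ t₀ : CoxExtremal.Space d,
        ENNReal.ofReal muY = CoxExtremal.meanStormIntegral Psi P PX t₀ →
        muZ = muY / ∫ ω, Psi ω 0 ∂P →
        TendstoInDistribution
          (fun (n : ℕ) ω => ((n + 1 : ℕ) : ℝ)⁻¹ • CoxExtremal.maxFirst Yc n ω) atTop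
          (fun ω => CoxExtremal.toPath (CoxExtremal.extremalField pZ ω)) (fun _ => P') Q := by
  open CoxExtremal in
  set C : ℝ≥0∞ := ∫⁻ ω, ENNReal.ofReal (Psi ω 0) ∂P with hC
  have hpos0 : 0 ≤ᵐ[P] fun ω => Psi ω 0 := by
    filter_upwards [hPsi_pos] with ω hω using (hω 0).le
  have hCm : C = ENNReal.ofReal (∫ ω, Psi ω 0 ∂P) :=
    (ofReal_integral_eq_lintegral_ofReal hPsi_int hpos0).symm
  -- Strict positivity of `Psi` is used here, so that division by `c_Ψ` is legitimate.
  have hm : 0 < ∫ ω, Psi ω 0 ∂P := by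
    rw [integral_pos_iff_support_of_nonneg_ae hpos0 hPsi_int]
    have : (Function.support fun ω => Psi ω 0) =ᵐ[P] Set.univ := by
      filter_upwards [hPsi_pos] with ω hω
      exact eq_true (hω 0).ne'
    rw [measure_congr this, measure_univ]
    exact one_pos
  have htY : ∀ᵐ ω ∂P, IsTame (range fun i => pY i ω) := by
    refine ae_isTame_of_hit_le (ν := (ENNReal.ofReal muY⁻¹ * C) • baseIntensity PX)
      (fun D hD => ?_) fun K η hK hη => ?_
    · exact (hCox.measure_hit_le hpY hD).trans
        (lintegral_stormIntensity hPsi_meas hPsi_stat muY PX hD).le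
    · refine ENNReal.mul_lt_top (ENNReal.mul_lt_top ENNReal.ofReal_lt_top ?_)
        (baseIntensity_markExceed_lt_top hX_int hK hη)
      rw [hCm]
      exact ENNReal.ofReal_lt_top
  have htZ : ∀ᵐ ω ∂Q, IsTame (range fun i => pZ i ω) := by
    refine ae_isTame_of_hit_le (fun D hD => hPoisson.measure_hit_le hpZ hD) fun K η hK hη => ?_
    rw [stormIntensity_one]
    exact ENNReal.mul_lt_top ENNReal.ofReal_lt_top (baseIntensity_markExceed_lt_top hX_int hK hη)
  refine ⟨finiteAndSampleContinuous_of_isTame hpY htY, finiteAndSampleContinuous_of_isTame hpZ htZ,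
    fun P' _ Yc hYc => ?_⟩
  -- This `c` solves `c * c_Ψ / muY = 1 / muZ`, the matching of mean intensities.
  have hconv : ∀ c : ℝ, 0 < c → c = muY / (∫ ω, Psi ω 0 ∂P) / muZ →
      TendstoInDistribution (fun (n : ℕ) ω => (c / ((n : ℝ) + 1)) • maxFirst Yc n ω) atTop
        (fun ω => toPath (extremalField pZ ω)) (fun _ => P') Q := by
    intro c hc hceq
    refine tendstoInDistribution_maxFirst hPsi_meas hPsi_stat hX_int hc ?_ hpY hCox htY hpZ
      hPoisson htZ hYc
    rw [← hC, hCm, ← ENNReal.ofReal_mul (by positivity), ← ENNReal.ofReal_mul hc.le, hceq]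
    congr 1
    field_simp
  constructor
  -- Constant norming functions `c / (n + 1)` and zero centring; `maxFirst Yc n` involves `n + 1`
  -- fields.
  · refine ⟨fun n => ContinuousMap.const _ (muY / (∫ ω, Psi ω 0 ∂P) / muZ / ((n : ℝ) + 1)),
      fun _ => 0, fun n t => ?_, ?_⟩
    · simp only [ContinuousMap.const_apply]
      positivity
    · convert hconv _ (by positivity) rfl using 3 with n ω
      ext t
      simp
  · intro t₀ _ hmu
    -- For `muZ = muY / c_Ψ` the matching constant is `c = 1`.
    convert hconv 1 one_pos (by rw [← hmu, div_self hmuZ.ne']) using 4 with n ω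
    push_cast
    rw [one_div]
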